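/- Let $\mathcal C$ be a finitely complete category. **Universal maps.** A *universal map* is an exponentiable map $\pi\colon\tilde{\mathcal U}\to\mathcal U$ together with a choice of pullbacks along it; for $A\colon\Gamma\to\mathcal U$ write $\Gamma.A\to\Gamma$ for the selected pullback. A *$\pi$-fibrancy structure* on $E\to B$ is a pair of maps $B\to\mathcal U$, $E\to\tilde{\mathcal U}$ forming a pullback square with $E\to B$ and $\pi$; a map that has one is a *$\pi$-fibration*. An *internal universe* of $\pi$ is a universal map $\pi_0\colon\tilde{\mathcal U}_0\to\mathcal U_0$ together with $\pi$-fibrancy structures on $\pi_0$ and on $\mathcal U_0\to 1$. Write $P_\pi(X)=\pi_*(\tilde{\mathcal U}\times X)$ (pushforward along $\pi$ of the projection $\tilde{\mathcal U}\times X\to\tilde{\mathcal U}$). A *$\Pi$-structure* on $\pi$ is a $\pi$-fibrancy structure on $P_\pi(\pi)$. A *$\Sigma$-structure* is a $\pi$-fibrancy structure on the composite of the generic pair $X\to E\to P_\pi(\mathcal U)$, where $E=\pi^*P_\pi(\mathcal U)$ and $X\to E$ is the selected pullback of $\pi$ along the map $E\to\tilde{\mathcal U}\times\mathcal U\to\mathcal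 U$ given by evaluation. **Identity types.** A *pre-$\mathrm{Id}$-structure* on $\pi$ is a commutative square from the diagonal $\tilde{\mathcal U}\to\tilde{\mathcal U}\times_{\mathcal U}\tilde{\mathcal U}$ to $\pi$. For $E\to B$ with a $\pi$-fibrancy structure it yields a $\pi$-fibration $\mathrm{ev}_\partial=(\mathrm{ev}_0,\mathrm{ev}_1)\colon \mathrm{Id}_B(E)\to E\times_BE$, the selected pullback of $\pi$ along the induced map $E\times_BE\to\tilde{\mathcal U}\times_{\mathcal U}\tilde{\mathcal U}\to\mathcal U$, and a map $\mathrm{refl}\colon E\to \mathrm{Id}_B(E)$ over the diagonal. An *$\mathrm{Id}$-homotopy* between maps $f,g\colon X\to E$ over $B$ is a map $H\colon X\to \mathrm{Id}_B(E)$ with $\mathrm{ev}_\partial H=(f,g)$; if $fi=gi$, it is *constant along $i$* when $Hi=\mathrm{refl}\cdot fi$. A *transport structure* is a map $\mathrm{ev}_0^*X\to\mathrm{ev}_1^*X$ over $\mathrm{Id}_{P_\pi(\mathcal U)}(E)$ for the generic pair $X\to E\to P_\pi(\mathcal U)$. **Lifts.** For $i\colon K\to L$ and $q\colon F\to D$,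 a *uniform family of lifts* (respectively *lower-half lifts*) of $i$ against $q$ chooses, for every object $Y$ and every commutative square from $Y\times i$ to $q$, a diagonal map $Y\times L\to F$ making both triangles commute (respectively the lower triangle, the one with target $D$, commute), naturally in $Y$. A pre-$\mathrm{Id}$-structure is a *full $\mathrm{Id}$-structure* if it carries a uniform family of lifts, in the slice over $\mathcal U$, of $\mathrm{refl}\colon\tilde{\mathcal U}\to\mathrm{Id}_{\mathcal U}(\tilde{\mathcal U})$ against $\mathcal U\times\pi\colon \mathcal U\times\tilde{\mathcal U}\to\mathcal U\times\mathcal U$. **Univalence.** Let $\pi_0$ be a universal map with a pre-$\mathrm{Id}$-structure $\mathrm{Id}_0$. Let $\mathrm{HIso}$ be the object representing the presheaf that sends $\Gamma$ to the set of tuples $(A,B,f,s,r,H_s,H_r)$ with $A,B\colon\Gamma\to\mathcal U_0$, maps $f\colon\Gamma.A\to\Gamma.B$ and $s,r\colon\Gamma.B\to\Gamma.A$ over $\Gamma$, an $\mathrm{Id}_0$-homotopy $H_s$ between $s\circ f$ and $\mathrm{id}_{\Gamma.A}$, and an $\mathrm{Id}_0$-homotopy $H_r$ between $f\circ r$ and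 $\mathrm{id}_{\Gamma.B}$, all over $\Gamma$; such an object exists. Let $\mathrm{src},\mathrm{tgt}\colon\mathrm{HIso}\to\mathcal U_0$ be the projections to $A$ and $B$, and let $\mathrm{trv}\colon\mathcal U_0\to\mathrm{HIso}$ be their common section sending $A$ to $(A,A,\mathrm{id},\mathrm{id},\mathrm{id},\mathrm{refl},\mathrm{refl})$. The pair $(\pi_0,\mathrm{Id}_0)$ is *pointed* (respectively *book*) *$\pi$-univalent* if $(\mathrm{src},\mathrm{tgt})\colon\mathrm{HIso}\to\mathcal U_0\times\mathcal U_0$ has a $\pi$-fibrancy structure and $\mathrm{trv}$ has a uniform family of lifts (respectively lower-half lifts) against $\pi$. **Theorem.** Let $\pi$ be a universal map in $\mathcal C$ with pre-$\mathrm{Id}$-, $\Pi$- and $\Sigma$-structures, and let $\pi_0$ be an internal universe of $\pi$ with pre-$\mathrm{Id}$-, $\Pi$- and $\Sigma$-structures $\mathrm{Id}_0,\Pi_0,\Sigma_0$. Then $\mathrm{src}$ and $\mathrm{tgt}$ are $\pi$-fibrations. Let $p$ be $\mathrm{src}$ or $\mathrm{tgt}$, with any $\pi$-fibrancy structure, and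 form $\mathrm{Id}_{\mathcal U_0}(\mathrm{HIso})$ and $\mathrm{Id}$-homotopies over $\mathcal U_0$ with respect to it. Consider the commutative square with left edge $\mathrm{trv}\colon\mathcal U_0\to\mathrm{HIso}$, right edge $\mathrm{ev}_\partial\colon\mathrm{Id}_{\mathcal U_0}(\mathrm{HIso})\to\mathrm{HIso}\times_{\mathcal U_0}\mathrm{HIso}$, upper edge $\mathrm{refl}\circ\mathrm{trv}$ and lower edge $(\mathrm{trv}\circ p,\mathrm{id})$. 1. If the pre-$\mathrm{Id}$-structure on $\pi$ has a transport structure, the following are equivalent: $(\pi_0,\mathrm{Id}_0)$ is book $\pi$-univalent; there is an $\mathrm{Id}$-homotopy between $\mathrm{trv}\circ p$ and $\mathrm{id}_{\mathrm{HIso}}$; the square has a diagonal making the lower triangle commute. 2. If the pre-$\mathrm{Id}$-structure on $\pi$ is a full $\mathrm{Id}$-structure, the following are equivalent: $(\pi_0,\mathrm{Id}_0)$ is pointed $\pi$-univalent; there is an $\mathrm{Id}$-homotopy between $\mathrm{trv}\circ p$ and $\mathrm{id}_{\mathrm{HIso}}$ that is constant along $\mathrm{trv}$; the square has a diagonal making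 both triangles commute. -/

import Mathlib

open CategoryTheory CategoryTheory.Limits

universe v u

set_option linter.unusedSectionVars false

noncomputable section

namespace UnivCat

section Lifting

variable {D : Type u} [Category.{v} D] [HasBinaryProducts D]

/-- A uniform family of lifts of `i : K ⟶ L` against `p : E ⟶ B`: a choice, for every object `X`,
of diagonal fillers for all commutative squares from `X × i` to `p`, natural in `X`. -/
structure UniformLifts {K L E B : D} (i : K ⟶ L) (p : E ⟶ B) where
  lift : ∀ {X : D} (a : X ⨯ K ⟶ E) (b : X ⨯ L ⟶ B), a ≫ p = prod.map (𝟙 X) i ≫ b → (X ⨯ L ⟶ E)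
  upper : ∀ {X : D} (a : X ⨯ K ⟶ E) (b : X ⨯ L ⟶ B) (h : a ≫ p = prod.map (𝟙 X) i ≫ b),
    prod.map (𝟙 X) i ≫ lift a b h = a
  lower : ∀ {X : D} (a : X ⨯ K ⟶ E) (b : X ⨯ L ⟶ B) (h : a ≫ p = prod.map (𝟙 X) i ≫ b),
    lift a b h ≫ p = b
  uniform : ∀ {X Y : D} (t : Y ⟶ X) (a : X ⨯ K ⟶ E) (b : X ⨯ L ⟶ B)
    (h : a ≫ p = prod.map (𝟙 X) i ≫ b)
    (h' : (prod.map t (𝟙 K) ≫ a) ≫ p = prod.map (𝟙 Y) i ≫ (prod.map t (𝟙 L) ≫ b)),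
    lift (prod.map t (𝟙 K) ≫ a) (prod.map t (𝟙 L) ≫ b) h' = prod.map t (𝟙 L) ≫ lift a b h

/-- A uniform family of lower-half lifts of `i : K ⟶ L` against `p : E ⟶ B`: as for
`UniformLifts`, but only the lower triangle of each filler is required to commute. -/
structure UniformLowerLifts {K L E B : D} (i : K ⟶ L) (p : E ⟶ B) where
  lift : ∀ {X : D} (a : X ⨯ K ⟶ E) (b : X ⨯ L ⟶ B), a ≫ p = prod.map (𝟙 X) i ≫ b → (X ⨯ L ⟶ E)
  lower : ∀ {X : D} (a : X ⨯ K ⟶ E) (b : X ⨯ L ⟶ B) (h : a ≫ p = prod.map (𝟙 X) i ≫ b),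
    lift a b h ≫ p = b
  uniform : ∀ {X Y : D} (t : Y ⟶ X) (a : X ⨯ K ⟶ E) (b : X ⨯ L ⟶ B)
    (h : a ≫ p = prod.map (𝟙 X) i ≫ b)
    (h' : (prod.map t (𝟙 K) ≫ a) ≫ p = prod.map (𝟙 Y) i ≫ (prod.map t (𝟙 L) ≫ b)),
    lift (prod.map t (𝟙 K) ≫ a) (prod.map t (𝟙 L) ≫ b) h' = prod.map t (𝟙 L) ≫ lift a b h

end Lifting

/-- A commutative square has a lower-half lift if it has a diagonal making the lower triangle
commute. -/
def HasLowerHalfLift {D : Type u} [Category.{v} D] {K L E B : D} {a : K ⟶ E} {i : K ⟶ L}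
    {p : E ⟶ B} {b : L ⟶ B} (_sq : CommSq a i p b) : Prop :=
  ∃ l : L ⟶ E, l ≫ p = b

variable {C : Type u} [Category.{v} C]

variable (C) in
/-- A universal map: an exponentiable map with a chosen right adjoint to postcomposition (that is,
a choice of pullbacks along it) and a chosen pushforward. -/
structure UniversalMap where
  Tm : C
  Ty : C
  map : Tm ⟶ Ty
  [chosenPullbacks : ChosenPullbacksAlong map]
  [exponentiable : ExponentiableMorphism map]

namespace UniversalMap

attribute [instance] UniversalMap.chosenPullbacks UniversalMap.exponentiable

variable (P : UniversalMap C)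

/-- The context extension `Γ.A`: the domain of the selected pullback of the universal map. -/
abbrev ext {Γ : C} (A : Γ ⟶ P.Ty) : C := ChosenPullbacksAlong.pullbackObj A P.map

/-- The selected pullback `Γ.A ⟶ Γ`. -/
abbrev disp {Γ : C} (A : Γ ⟶ P.Ty) : P.ext A ⟶ Γ := ChosenPullbacksAlong.fst A P.map

/-- The generic term `Γ.A ⟶ Tm`. -/
abbrev var {Γ : C} (A : Γ ⟶ P.Ty) : P.ext A ⟶ P.Tm := ChosenPullbacksAlong.snd A P.map

/-- The map `Δ.A[σ] ⟶ Γ.A` over `σ : Δ ⟶ Γ`, for `A' = A[σ]`. -/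
def wk {Γ Δ : C} {σ : Δ ⟶ Γ} {A : Γ ⟶ P.Ty} {A' : Δ ⟶ P.Ty} (h : σ ≫ A = A') :
    P.ext A' ⟶ P.ext A :=
  ChosenPullbacksAlong.lift (P.disp A' ≫ σ) (P.var A')
    (by rw [Category.assoc, h]; exact ChosenPullbacksAlong.condition)

end UniversalMap

/-- A fibrancy structure on `e : E ⟶ B`: a name `B ⟶ Ty` and a point `E ⟶ Tm` exhibiting `e` as
a pullback of the universal map. -/
structure Fibrancy (P : UniversalMap C) {E B : C} (e : E ⟶ B) where
  name : B ⟶ P.Ty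
  point : E ⟶ P.Tm
  isPullback : IsPullback point e P.map name

/-- The canonical fibrancy structure on a selected pullback. -/
abbrev Fibrancy.canonical (P : UniversalMap C) {Γ : C} (A : Γ ⟶ P.Ty) : Fibrancy P (P.disp A) where
  name := A
  point := P.var A
  isPullback := (ChosenPullbacksAlong.isPullback A P.map).flip

variable [HasFiniteLimits C]

/-- An internal fibrant universe: a universal map `univ` such that both `univ.Tm ⟶ univ.Ty` and
`univ.Ty ⟶ 1` are fibrations for the ambient universal map. -/
structure InternalUniverse (P : UniversalMap C) where
  univ : UniversalMap C
  el : Fibrancy P univ.map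
  code : Fibrancy P (terminal.from univ.Ty)

/-- A pre-`Id`-type structure: a commutative square from the diagonal of the universal map to the
universal map. -/
structure PreId (P : UniversalMap C) where
  Id : pullback P.map P.map ⟶ P.Ty
  reflName : P.Tm ⟶ P.Tm
  w : reflName ≫ P.map = pullback.diagonal P.map ≫ Id

namespace UniversalMap

variable (P : UniversalMap C)

/-- The pushforward `π_*(Tm × X)` as an object over `Ty`. -/
abbrev polyOver (X : C) : Over P.Ty :=
  (ExponentiableMorphism.pushforward P.map).obj (Over.mk (prod.fst : P.Tm ⨯ X ⟶ P.Tm))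

/-- The value at `X` of the polynomial functor of the universal map. -/
abbrev polyObj (X : C) : C := (P.polyOver X).left

/-- The structure map `π_*(Tm × X) ⟶ Ty`. -/
abbrev polyBase (X : C) : P.polyObj X ⟶ P.Ty := (P.polyOver X).hom

/-- The action on maps of the polynomial functor of the universal map. -/
def polyMap {X Y : C} (g : X ⟶ Y) : P.polyObj X ⟶ P.polyObj Y :=
  ((ExponentiableMorphism.pushforward P.map).map
    (Over.homMk (prod.map (𝟙 P.Tm) g) (by simp) :
      Over.mk (prod.fst : P.Tm ⨯ X ⟶ P.Tm) ⟶ Over.mk (prod.fst : P.Tm ⨯ Y ⟶ P.Tm))).left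

/-- The counit `π^* π_*(Tm × X) ⟶ Tm × X`. -/
def polyEv (X : C) : P.ext (P.polyBase X) ⟶ P.Tm ⨯ X :=
  ((ExponentiableMorphism.ev P.map).app (Over.mk (prod.fst : P.Tm ⨯ X ⟶ P.Tm))).left

/-- The first map `ev^*(Tm × Tm) ⟶ π^* π_*(Tm × Ty)` of the generic composite: the pullback of the
universal map along `π^* π_*(Tm × Ty) ⟶ Tm × Ty ⟶ Ty`. -/
abbrev genFib : P.ext (P.polyEv P.Ty ≫ prod.snd) ⟶ P.ext (P.polyBase P.Ty) :=
  P.disp (P.polyEv P.Ty ≫ prod.snd)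

/-- The generic composite of the universal map with itself. -/
def genComp : P.ext (P.polyEv P.Ty ≫ prod.snd) ⟶ P.polyObj P.Ty :=
  P.genFib ≫ P.disp (P.polyBase P.Ty)

end UniversalMap

/-- An extensional `Π`-type structure. -/
abbrev PiStructure (P : UniversalMap C) := Fibrancy P (P.polyMap P.map)

/-- An extensional `Σ`-type structure. -/
abbrev SigmaStructure (P : UniversalMap C) := Fibrancy P P.genComp

namespace PreId

variable {P : UniversalMap C} (I : PreId P)

/-- The generic identity type, as the selected pullback of the universal map along `Id`. -/
abbrev gen : C := P.ext I.Id

/-- The generic map `refl` into the generic identity type. -/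
def genRefl : P.Tm ⟶ I.gen :=
  ChosenPullbacksAlong.lift (pullback.diagonal P.map) I.reflName I.w.symm

@[simp]
lemma genRefl_disp : I.genRefl ≫ P.disp I.Id = pullback.diagonal P.map := by
  simp [genRefl]

/-- `refl` as a map in the slice over `Ty`. -/
def genReflOver :
    Over.mk P.map ⟶ Over.mk (P.disp I.Id ≫ pullback.fst P.map P.map ≫ P.map) :=
  Over.homMk I.genRefl (by
    change I.genRefl ≫ P.disp I.Id ≫ pullback.fst P.map P.map ≫ P.map = P.map
    rw [← Category.assoc, genRefl_disp, pullback.diagonal_fst_assoc])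

section Fibred

variable {E B : C} {e : E ⟶ B} (φ : Fibrancy P e)

/-- The map `E ×_B E ⟶ Tm ×_Ty Tm` induced by a fibrancy structure. -/
def pairMap : pullback e e ⟶ pullback P.map P.map :=
  pullback.lift (pullback.fst e e ≫ φ.point) (pullback.snd e e ≫ φ.point)
    (by simp only [Category.assoc, φ.isPullback.w, pullback.condition_assoc])

/-- The fibred identity type `Id_B(E)` of a fibration. -/
abbrev obj : C := P.ext (pairMap φ ≫ I.Id)

/-- The endpoint map `Id_B(E) ⟶ E ×_B E`. -/
abbrev ends : I.obj φ ⟶ pullback e e := P.disp (pairMap φ ≫ I.Id)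

/-- The first endpoint map `Id_B(E) ⟶ E`. -/
abbrev ev₀ : I.obj φ ⟶ E := I.ends φ ≫ pullback.fst e e

/-- The second endpoint map `Id_B(E) ⟶ E`. -/
abbrev ev₁ : I.obj φ ⟶ E := I.ends φ ≫ pullback.snd e e


/-- The reflexivity map `E ⟶ Id_B(E)`. -/
def refl : E ⟶ I.obj φ :=
  ChosenPullbacksAlong.lift (pullback.diagonal e) (φ.point ≫ I.reflName) (by
    have h : pullback.diagonal e ≫ pairMap φ = φ.point ≫ pullback.diagonal P.map := by
      ext <;> simp [pairMap, pullback.lift_fst, pullback.lift_snd]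
    rw [Category.assoc, I.w, reassoc_of% h])

@[simp]
lemma refl_ends : I.refl φ ≫ I.ends φ = pullback.diagonal e := by
  simp [refl]

@[simp]
lemma refl_var : I.refl φ ≫ P.var (pairMap φ ≫ I.Id) = φ.point ≫ I.reflName := by
  simp [refl]

/-- An `Id`-homotopy between two maps `f, g : X ⟶ E` over `B`, where `e : E ⟶ B` is a fibration. -/
@[ext]
structure Homotopy {X : C} (f g : X ⟶ E) (h : f ≫ e = g ≫ e) where
  hom : X ⟶ I.obj φ
  w : hom ≫ I.ends φ = pullback.lift f g h

/-- An `Id`-homotopy between `f, g : X ⟶ E` over `B` that is constant along `i : W ⟶ X`, where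
`i ≫ f = i ≫ g`. -/
structure ConstHomotopy {X W : C} (i : W ⟶ X) (f g : X ⟶ E) (h : f ≫ e = g ≫ e)
    (_hi : i ≫ f = i ≫ g) extends I.Homotopy φ f g h where
  const : i ≫ hom = (i ≫ f) ≫ I.refl φ

end Fibred

/-- A `J`-elimination structure: a stable choice of lifts, in the slice over `Ty`, of `refl`
against `Ty × Tm ⟶ Ty × Ty`. -/
def JStructure :=
  UniformLifts I.genReflOver
    (Over.homMk (prod.map (𝟙 P.Ty) P.map) (by simp) :
      Over.mk (prod.fst : P.Ty ⨯ P.Tm ⟶ P.Ty) ⟶ Over.mk (prod.fst : P.Ty ⨯ P.Ty ⟶ P.Ty))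

/-- A transport structure: a map `ev₀^* X ⟶ ev₁^* X` over `Id_B(E)`, where `X ⟶ E ⟶ B` is the
generic pair of composable fibrations. -/
structure TransportStructure where
  map : pullback (I.ev₀ (Fibrancy.canonical P (P.polyBase P.Ty))) P.genFib ⟶
    pullback (I.ev₁ (Fibrancy.canonical P (P.polyBase P.Ty))) P.genFib
  w : map ≫ pullback.fst (I.ev₁ (Fibrancy.canonical P (P.polyBase P.Ty))) P.genFib =
    pullback.fst (I.ev₀ (Fibrancy.canonical P (P.polyBase P.Ty))) P.genFib

end PreId

/-! ### The generic object of homotopy isomorphisms -/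

/-- The data, in context `Γ`, of two types `A` and `B`, a map `f : Γ.A ⟶ Γ.B` over `Γ`, and two
maps `s, r : Γ.B ⟶ Γ.A` over `Γ` together with `Id`-homotopies from the composite of `f` and `s` to
the identity of `Γ.A` and from the composite of `r` and `f` to the identity of `Γ.B`. -/
structure HIsoData {P : UniversalMap C} (I : PreId P) (Γ : C) where
  A : Γ ⟶ P.Ty
  B : Γ ⟶ P.Ty
  f : P.ext A ⟶ P.ext B
  s : P.ext B ⟶ P.ext A
  r : P.ext B ⟶ P.ext A
  f_disp : f ≫ P.disp B = P.disp A
  s_disp : s ≫ P.disp A = P.disp B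
  r_disp : r ≫ P.disp A = P.disp B
  Hs : I.Homotopy (Fibrancy.canonical P A) (f ≫ s) (𝟙 (P.ext A)) (by simp [f_disp, s_disp])
  Hr : I.Homotopy (Fibrancy.canonical P B) (r ≫ f) (𝟙 (P.ext B)) (by simp [f_disp, r_disp])

section Reindexing

variable {P : UniversalMap C}

@[simp]
lemma wk_disp {Γ Δ : C} {σ : Δ ⟶ Γ} {A : Γ ⟶ P.Ty} {A' : Δ ⟶ P.Ty} (h : σ ≫ A = A') :
    P.wk h ≫ P.disp A = P.disp A' ≫ σ := by
  simp [UniversalMap.wk]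

@[simp]
lemma wk_var {Γ Δ : C} {σ : Δ ⟶ Γ} {A : Γ ⟶ P.Ty} {A' : Δ ⟶ P.Ty} (h : σ ≫ A = A') :
    P.wk h ≫ P.var A = P.var A' := by
  simp [UniversalMap.wk]

lemma ext_hom {W Γ : C} {A : Γ ⟶ P.Ty} {a b : W ⟶ P.ext A} (h : a ≫ P.disp A = b ≫ P.disp A)
    (h' : a ≫ P.var A = b ≫ P.var A) : a = b :=
  ChosenPullbacksAlong.hom_ext _ _ h h'

lemma wk_id {Γ : C} {A : Γ ⟶ P.Ty} (h : 𝟙 Γ ≫ A = A) : P.wk h = 𝟙 _ := by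
  apply ext_hom <;> simp

lemma wk_wk {Γ Δ Θ : C} {σ : Δ ⟶ Γ} {τ : Θ ⟶ Δ} {A : Γ ⟶ P.Ty} {A' : Δ ⟶ P.Ty}
    {A'' : Θ ⟶ P.Ty} (h : σ ≫ A = A') (h' : τ ≫ A' = A'') (h'' : (τ ≫ σ) ≫ A = A'') :
    P.wk h' ≫ P.wk h = P.wk h'' := by
  apply ext_hom <;> simp [Category.assoc, ← reassoc_of% (wk_disp h')]

lemma wk_wk_assoc {Γ Δ Θ W : C} {σ : Δ ⟶ Γ} {τ : Θ ⟶ Δ} {A : Γ ⟶ P.Ty} {A' : Δ ⟶ P.Ty}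
    {A'' : Θ ⟶ P.Ty} (h : σ ≫ A = A') (h' : τ ≫ A' = A'') (h'' : (τ ≫ σ) ≫ A = A'')
    (k : P.ext A ⟶ W) : P.wk h' ≫ P.wk h ≫ k = P.wk h'' ≫ k := by
  rw [← Category.assoc, wk_wk h h' h'']

/-- The unique map over `Δ` between reindexed contexts that restricts a map over `Γ`. -/
def reindexHom {Γ Δ : C} {σ : Δ ⟶ Γ} {A B : Γ ⟶ P.Ty} {A' B' : Δ ⟶ P.Ty} (hA : σ ≫ A = A')
    (hB : σ ≫ B = B') (f : P.ext A ⟶ P.ext B) (hf : f ≫ P.disp B = P.disp A) :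
    P.ext A' ⟶ P.ext B' :=
  ChosenPullbacksAlong.lift (P.disp A') (P.wk hA ≫ f ≫ P.var B) (by
    rw [Category.assoc, Category.assoc, ← ChosenPullbacksAlong.condition, reassoc_of% hf,
      ← Category.assoc, wk_disp, Category.assoc, hB])

@[simp]
lemma reindexHom_disp {Γ Δ : C} {σ : Δ ⟶ Γ} {A B : Γ ⟶ P.Ty} {A' B' : Δ ⟶ P.Ty} (hA : σ ≫ A = A')
    (hB : σ ≫ B = B') (f : P.ext A ⟶ P.ext B) (hf : f ≫ P.disp B = P.disp A) :
    reindexHom hA hB f hf ≫ P.disp B' = P.disp A' := by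
  simp [reindexHom]

lemma reindexHom_wk {Γ Δ : C} {σ : Δ ⟶ Γ} {A B : Γ ⟶ P.Ty} {A' B' : Δ ⟶ P.Ty} (hA : σ ≫ A = A')
    (hB : σ ≫ B = B') (f : P.ext A ⟶ P.ext B) (hf : f ≫ P.disp B = P.disp A) :
    reindexHom hA hB f hf ≫ P.wk hB = P.wk hA ≫ f := by
  apply ext_hom
  · simp [reindexHom, hf]
  · simp [reindexHom]

lemma wk_comp_reindexHom {Γ Δ : C} {σ : Δ ⟶ Γ} {A B : Γ ⟶ P.Ty} {A' B' : Δ ⟶ P.Ty}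
    (hA : σ ≫ A = A') (hB : σ ≫ B = B') (f : P.ext A ⟶ P.ext B) (hf : f ≫ P.disp B = P.disp A)
    (s : P.ext B ⟶ P.ext A) (hs : s ≫ P.disp A = P.disp B) :
    P.wk hA ≫ f ≫ s = (reindexHom hA hB f hf ≫ reindexHom hB hA s hs) ≫ P.wk hA := by
  have h₁ := reindexHom_wk hA hB f hf
  have h₂ := reindexHom_wk hB hA s hs
  generalize reindexHom hA hB f hf = f' at *
  generalize reindexHom hB hA s hs = s' at *
  rw [Category.assoc, h₂, reassoc_of% h₁]

/-! Maps into the value at `X` of the polynomial functor are pairs of `A : Γ ⟶ Ty` and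
`T : Γ.A ⟶ X`. -/

lemma pullback_map_left {Γ Δ : C} {σ : Δ ⟶ Γ} {A : Γ ⟶ P.Ty} {A' : Δ ⟶ P.Ty} (h : σ ≫ A = A') :
    ((ChosenPullbacksAlong.pullback P.map).map
      (Over.homMk σ h : Over.mk A' ⟶ Over.mk A)).left = P.wk h := by
  apply ext_hom
  · rw [wk_disp]
    exact congr_arg CommaMorphism.left ((ChosenPullbacksAlong.mapPullbackAdj P.map).counit.naturality
      (Over.homMk σ h : Over.mk A' ⟶ Over.mk A))
  · rw [wk_var]
    exact Over.w ((ChosenPullbacksAlong.pullback P.map).map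
      (Over.homMk σ h : Over.mk A' ⟶ Over.mk A))

/-- A map `Γ.A ⟶ X` as a map `Γ.A ⟶ Tm × X` over `Tm`. -/
def termOver {Γ X : C} (A : Γ ⟶ P.Ty) (T : P.ext A ⟶ X) :
    (ChosenPullbacksAlong.pullback P.map).obj (Over.mk A) ⟶
      Over.mk (prod.fst : P.Tm ⨯ X ⟶ P.Tm) :=
  Over.homMk (prod.lift (P.var A) T) (prod.lift_fst _ _)

/-- The map into `π_*(Tm × X)` classifying `A : Γ ⟶ Ty` and `T : Γ.A ⟶ X`. -/
def classify {Γ X : C} (A : Γ ⟶ P.Ty) (T : P.ext A ⟶ X) : Γ ⟶ P.polyObj X :=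
  ((ExponentiableMorphism.pullbackPushforwardAdj P.map).homEquiv (Over.mk A) _
    (termOver A T)).left

lemma classify_base {Γ X : C} (A : Γ ⟶ P.Ty) (T : P.ext A ⟶ X) :
    classify A T ≫ P.polyBase X = A :=
  Over.w ((ExponentiableMorphism.pullbackPushforwardAdj P.map).homEquiv (Over.mk A) _
    (termOver A T))

lemma comp_classify {Γ Δ X : C} {σ : Δ ⟶ Γ} {A : Γ ⟶ P.Ty} {A' : Δ ⟶ P.Ty} (h : σ ≫ A = A')
    (T : P.ext A ⟶ X) : σ ≫ classify A T = classify A' (P.wk h ≫ T) := by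
  have key := (ExponentiableMorphism.pullbackPushforwardAdj P.map).homEquiv_naturality_left
    (Over.homMk σ h : Over.mk A' ⟶ Over.mk A) (termOver A T)
  have e : (ChosenPullbacksAlong.pullback P.map).map
      (Over.homMk σ h : Over.mk A' ⟶ Over.mk A) ≫ termOver A T = termOver A' (P.wk h ≫ T) := by
    apply Over.OverMorphism.ext
    rw [Over.comp_left, pullback_map_left]
    change P.wk h ≫ prod.lift (P.var A) T = prod.lift (P.var A') (P.wk h ≫ T)
    rw [prod.comp_lift, wk_var]
  rw [e] at key
  exact (congr_arg CommaMorphism.left key).symm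

lemma classify_polyMap {Γ X Y : C} (A : Γ ⟶ P.Ty) (T : P.ext A ⟶ X) (g : X ⟶ Y) :
    classify A T ≫ P.polyMap g = classify A (T ≫ g) := by
  have key := (ExponentiableMorphism.pullbackPushforwardAdj P.map).homEquiv_naturality_right
    (termOver A T) (Over.homMk (prod.map (𝟙 P.Tm) g) (by simp) :
      Over.mk (prod.fst : P.Tm ⨯ X ⟶ P.Tm) ⟶ Over.mk (prod.fst : P.Tm ⨯ Y ⟶ P.Tm))
  have e : termOver A T ≫ (Over.homMk (prod.map (𝟙 P.Tm) g) (by simp) :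
      Over.mk (prod.fst : P.Tm ⨯ X ⟶ P.Tm) ⟶ Over.mk (prod.fst : P.Tm ⨯ Y ⟶ P.Tm)) =
      termOver A (T ≫ g) := by
    apply Over.OverMorphism.ext
    change prod.lift (P.var A) T ≫ prod.map (𝟙 P.Tm) g = prod.lift (P.var A) (T ≫ g)
    simp
  rw [e] at key
  exact (congr_arg CommaMorphism.left key).symm

lemma classify_injective {Γ X : C} (A : Γ ⟶ P.Ty) {T T' : P.ext A ⟶ X}
    (h : classify A T = classify A T') : T = T' := by
  have h1 : termOver A T = termOver A T' :=
    ((ExponentiableMorphism.pullbackPushforwardAdj P.map).homEquiv (Over.mk A) _).injective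
      (Over.OverMorphism.ext h)
  have h2 : prod.lift (P.var A) T = prod.lift (P.var A) T' := congr_arg CommaMorphism.left h1
  rw [← prod.lift_snd (P.var A) T, h2, prod.lift_snd]

lemma classify_surjective {Γ X : C} (m : Γ ⟶ P.polyObj X) (A : Γ ⟶ P.Ty)
    (h : m ≫ P.polyBase X = A) : ∃ T, classify A T = m := by
  let m' : Over.mk A ⟶ P.polyOver X := Over.homMk m h
  let t := ((ExponentiableMorphism.pullbackPushforwardAdj P.map).homEquiv (Over.mk A) _).symm m'
  let t' : P.ext A ⟶ P.Tm ⨯ X := t.left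
  have ht' : t' ≫ prod.fst = P.var A := Over.w t
  refine ⟨t' ≫ prod.snd, ?_⟩
  have e : termOver A (t' ≫ prod.snd) = t := by
    apply Over.OverMorphism.ext
    change prod.lift (P.var A) (t' ≫ prod.snd) = t'
    apply Limits.prod.hom_ext
    · rw [prod.lift_fst, ht']
    · rw [prod.lift_snd]
  unfold classify
  rw [e]
  simp only [t, Equiv.apply_symm_apply]
  rfl

/-- For `T : R.A ⟶ Ty`, there is an object over `R` classifying the terms of type `T`: the pullback
of the value of the polynomial functor at the universal map along the map classifying `T`. -/
lemma exists_sections {R : C} (A : R ⟶ P.Ty) (T : P.ext A ⟶ P.Ty) :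
    ∃ (S : C) (p : S ⟶ R) (τ : P.ext (p ≫ A) ⟶ P.Tm),
      τ ≫ P.map = P.wk rfl ≫ T ∧
      (∀ {Δ : C} (g g' : Δ ⟶ S) (A' : Δ ⟶ P.Ty) (h : g ≫ p ≫ A = A') (h' : g' ≫ p ≫ A = A'),
        g ≫ p = g' ≫ p → P.wk h ≫ τ = P.wk h' ≫ τ → g = g') ∧
      (∀ {Δ : C} (σ : Δ ⟶ R) (A' : Δ ⟶ P.Ty) (h : σ ≫ A = A') (t : P.ext A' ⟶ P.Tm),
        t ≫ P.map = P.wk h ≫ T →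
        ∃ g : Δ ⟶ S, g ≫ p = σ ∧ ∀ h' : g ≫ p ≫ A = A', P.wk h' ≫ τ = t) := by
  let q : pullback (classify A T) (P.polyMap P.map) ⟶ R := pullback.fst _ _
  let m : pullback (classify A T) (P.polyMap P.map) ⟶ P.polyObj P.Tm := pullback.snd _ _
  have hm : m ≫ P.polyMap P.map = classify (q ≫ A) (P.wk rfl ≫ T) := by
    rw [← comp_classify rfl]; exact pullback.condition.symm
  have hbase : P.polyMap P.map ≫ P.polyBase P.Ty = P.polyBase P.Tm :=
    Over.w ((ExponentiableMorphism.pushforward P.map).map _)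
  have hb : m ≫ P.polyBase P.Tm = q ≫ A := by
    rw [← hbase, ← Category.assoc, hm, classify_base]
  obtain ⟨τ, hτ⟩ := classify_surjective m (q ≫ A) hb
  refine ⟨_, q, τ, ?_, ?_, ?_⟩
  · apply classify_injective
    rw [← classify_polyMap, hτ, hm]
  · intro Δ g g' A' h h' hq ht
    apply pullback.hom_ext hq
    change g ≫ m = g' ≫ m
    rw [← hτ, comp_classify h, comp_classify h', ht]
  · intro Δ σ A' h t ht
    have w : σ ≫ classify A T = classify A' t ≫ P.polyMap P.map := by
      rw [comp_classify h, classify_polyMap, ht]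
    refine ⟨pullback.lift σ (classify A' t) w, pullback.lift_fst _ _ _, fun h' => ?_⟩
    apply classify_injective
    rw [← comp_classify, hτ]
    exact pullback.lift_snd _ _ _


variable {I : PreId P}

lemma lift_pairMap {E B X : C} {e : E ⟶ B} (φ : Fibrancy P e) (f g : X ⟶ E) (h : f ≫ e = g ≫ e)
    (h' : (f ≫ φ.point) ≫ P.map = (g ≫ φ.point) ≫ P.map) :
    pullback.lift f g h ≫ PreId.pairMap φ = pullback.lift (f ≫ φ.point) (g ≫ φ.point) h' := by
  apply pullback.hom_ext
  · simp only [PreId.pairMap, Category.assoc, pullback.lift_fst, pullback.lift_fst_assoc]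
  · simp only [PreId.pairMap, Category.assoc, pullback.lift_snd, pullback.lift_snd_assoc]

/-- The type over `Γ.A` of identifications of an endomorphism `t` of `Γ.A` over `Γ` with the
identity. -/
abbrev idTy (I : PreId P) {Γ : C} (A : Γ ⟶ P.Ty) (t : P.ext A ⟶ P.ext A)
    (ht : t ≫ P.disp A = 𝟙 _ ≫ P.disp A) : P.ext A ⟶ P.Ty :=
  pullback.lift t (𝟙 _) ht ≫ PreId.pairMap (Fibrancy.canonical P A) ≫ I.Id

lemma wk_idTy {Γ Δ : C} {σ : Δ ⟶ Γ} {A : Γ ⟶ P.Ty} {A' : Δ ⟶ P.Ty} (h : σ ≫ A = A')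
    (t : P.ext A ⟶ P.ext A) (ht : t ≫ P.disp A = 𝟙 _ ≫ P.disp A)
    (t' : P.ext A' ⟶ P.ext A') (ht' : t' ≫ P.disp A' = 𝟙 _ ≫ P.disp A')
    (hc : P.wk h ≫ t = t' ≫ P.wk h) :
    P.wk h ≫ idTy I A t ht = idTy I A' t' ht' := by
  have h1 : (t' ≫ P.var A') ≫ P.map = (𝟙 _ ≫ P.var A') ≫ P.map := by
    rw [Category.assoc, Category.assoc, ← ChosenPullbacksAlong.condition, reassoc_of% ht', Category.id_comp]
  have h2 : (t ≫ P.var A) ≫ P.map = (𝟙 _ ≫ P.var A) ≫ P.map := by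
    rw [Category.assoc, Category.assoc, ← ChosenPullbacksAlong.condition, reassoc_of% ht, Category.id_comp]
  unfold idTy
  rw [← Category.assoc (pullback.lift t _ _), ← Category.assoc (pullback.lift t' _ _),
    ← Category.assoc (P.wk h),
    lift_pairMap (Fibrancy.canonical P A) t (𝟙 _) ht h2,
    lift_pairMap (Fibrancy.canonical P A') t' (𝟙 _) ht' h1]
  congr 1
  apply pullback.hom_ext
  · rw [Category.assoc, pullback.lift_fst, pullback.lift_fst, reassoc_of% hc]
    simp
  · rw [Category.assoc, pullback.lift_snd, pullback.lift_snd]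
    simp

lemma homotopy_var {Γ : C} {A : Γ ⟶ P.Ty} {t : P.ext A ⟶ P.ext A}
    {ht : t ≫ P.disp A = 𝟙 _ ≫ P.disp A} (H : I.Homotopy (Fibrancy.canonical P A) t (𝟙 _) ht) :
    (H.hom ≫ P.var _) ≫ P.map = idTy I A t ht := by
  rw [Category.assoc, ← ChosenPullbacksAlong.condition, ← Category.assoc, H.w]

/-- A term of `idTy` as an `Id`-homotopy. -/
def homotopyOfTerm {Γ : C} {A : Γ ⟶ P.Ty} {t : P.ext A ⟶ P.ext A}
    {ht : t ≫ P.disp A = 𝟙 _ ≫ P.disp A} (τ : P.ext A ⟶ P.Tm) (hτ : τ ≫ P.map = idTy I A t ht) :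
    I.Homotopy (Fibrancy.canonical P A) t (𝟙 _) ht where
  hom := ChosenPullbacksAlong.lift (pullback.lift t (𝟙 _) ht) τ hτ.symm
  w := ChosenPullbacksAlong.lift_fst _ _ _

@[simp]
lemma homotopyOfTerm_var {Γ : C} {A : Γ ⟶ P.Ty} {t : P.ext A ⟶ P.ext A}
    {ht : t ≫ P.disp A = 𝟙 _ ≫ P.disp A} (τ : P.ext A ⟶ P.Tm) (hτ : τ ≫ P.map = idTy I A t ht) :
    (homotopyOfTerm τ hτ).hom ≫ P.var _ = τ :=
  ChosenPullbacksAlong.lift_snd _ _ hτ.symm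

lemma homotopy_ext {Γ : C} {A : Γ ⟶ P.Ty} {t : P.ext A ⟶ P.ext A}
    {ht : t ≫ P.disp A = 𝟙 _ ≫ P.disp A}
    {H H' : I.Homotopy (Fibrancy.canonical P A) t (𝟙 _) ht}
    (h : H.hom ≫ P.var _ = H'.hom ≫ P.var _) : H = H' := by
  apply PreId.Homotopy.ext
  apply ext_hom _ h
  rw [H.w, H'.w]

/-- `x` is the restriction of `y` along `σ`. -/
structure IsReindexing {Γ Δ : C} (σ : Δ ⟶ Γ) (x : HIsoData I Δ) (y : HIsoData I Γ) : Prop where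
  hA : σ ≫ y.A = x.A
  hB : σ ≫ y.B = x.B
  hf : P.wk hA ≫ y.f = x.f ≫ P.wk hB
  hs : P.wk hB ≫ y.s = x.s ≫ P.wk hA
  hr : P.wk hB ≫ y.r = x.r ≫ P.wk hA
  hHs : P.wk hA ≫ y.Hs.hom ≫ P.var _ = x.Hs.hom ≫ P.var _
  hHr : P.wk hB ≫ y.Hr.hom ≫ P.var _ = x.Hr.hom ≫ P.var _

lemma hom_eq_of_wk {Γ Δ : C} {σ : Δ ⟶ Γ} {A : Γ ⟶ P.Ty} {A' : Δ ⟶ P.Ty} (h : σ ≫ A = A')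
    {W : C} {a b : W ⟶ P.ext A'} (hd : a ≫ P.disp A' = b ≫ P.disp A')
    (hw : a ≫ P.wk h = b ≫ P.wk h) : a = b := by
  apply ext_hom hd
  rw [← wk_var h, reassoc_of% hw]

lemma IsReindexing.unique {Γ Δ : C} {σ : Δ ⟶ Γ} {x x' : HIsoData I Δ} {y : HIsoData I Γ}
    (h : IsReindexing σ x y) (h' : IsReindexing σ x' y) : x = x' := by
  obtain ⟨A, B, f, s, r, f1, s1, r1, Hs, Hr⟩ := x
  obtain ⟨A', B', f', s', r', f1', s1', r1', Hs', Hr'⟩ := x'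
  obtain ⟨hA, hB, hf, hs, hr, hHs, hHr⟩ := h
  obtain ⟨hA', hB', hf', hs', hr', hHs', hHr'⟩ := h'
  obtain rfl : A = A' := hA.symm.trans hA'
  obtain rfl : B = B' := hB.symm.trans hB'
  obtain rfl : f = f' := hom_eq_of_wk hB (f1.trans f1'.symm) (hf.symm.trans hf')
  obtain rfl : s = s' := hom_eq_of_wk hA (s1.trans s1'.symm) (hs.symm.trans hs')
  obtain rfl : r = r' := hom_eq_of_wk hA (r1.trans r1'.symm) (hr.symm.trans hr')
  obtain rfl : Hs = Hs' := homotopy_ext (hHs.symm.trans hHs')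
  obtain rfl : Hr = Hr' := homotopy_ext (hHr.symm.trans hHr')
  rfl

lemma IsReindexing.refl {Γ : C} (x : HIsoData I Γ) : IsReindexing (𝟙 Γ) x x where
  hA := Category.id_comp _
  hB := Category.id_comp _
  hf := by simp [wk_id]
  hs := by simp [wk_id]
  hr := by simp [wk_id]
  hHs := by simp [wk_id]
  hHr := by simp [wk_id]

lemma IsReindexing.comp {Γ Δ Θ : C} {σ : Δ ⟶ Γ} {τ : Θ ⟶ Δ} {x : HIsoData I Θ}
    {y : HIsoData I Δ} {z : HIsoData I Γ} (h : IsReindexing τ x y) (h' : IsReindexing σ y z) :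
    IsReindexing (τ ≫ σ) x z := by
  have hA : (τ ≫ σ) ≫ z.A = x.A := by rw [Category.assoc, h'.hA, h.hA]
  have hB : (τ ≫ σ) ≫ z.B = x.B := by rw [Category.assoc, h'.hB, h.hB]
  have eA := wk_wk h'.hA h.hA hA
  have eB := wk_wk h'.hB h.hB hB
  refine ⟨hA, hB, ?_, ?_, ?_, ?_, ?_⟩
  · rw [← eA, ← eB, Category.assoc, h'.hf, reassoc_of% h.hf]
  · rw [← eA, ← eB, Category.assoc, h'.hs, reassoc_of% h.hs]
  · rw [← eA, ← eB, Category.assoc, h'.hr, reassoc_of% h.hr]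
  · rw [← eA, Category.assoc, h'.hHs, h.hHs]
  · rw [← eB, Category.assoc, h'.hHr, h.hHr]

/-- Restriction of `HIsoData` along a map of contexts. -/
def HIsoData.reindex {Γ Δ : C} (σ : Δ ⟶ Γ) (y : HIsoData I Γ) : HIsoData I Δ where
  A := σ ≫ y.A
  B := σ ≫ y.B
  f := reindexHom rfl rfl y.f y.f_disp
  s := reindexHom rfl rfl y.s y.s_disp
  r := reindexHom rfl rfl y.r y.r_disp
  f_disp := reindexHom_disp _ _ _ _
  s_disp := reindexHom_disp _ _ _ _
  r_disp := reindexHom_disp _ _ _ _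
  Hs := homotopyOfTerm (P.wk rfl ≫ y.Hs.hom ≫ P.var _) (by
    rw [Category.assoc, homotopy_var]
    apply wk_idTy
    exact wk_comp_reindexHom _ _ _ _ _ _)
  Hr := homotopyOfTerm (P.wk rfl ≫ y.Hr.hom ≫ P.var _) (by
    rw [Category.assoc, homotopy_var]
    apply wk_idTy
    exact wk_comp_reindexHom _ _ _ _ _ _)

lemma HIsoData.isReindexing {Γ Δ : C} (σ : Δ ⟶ Γ) (y : HIsoData I Γ) :
    IsReindexing σ (y.reindex σ) y := by
  refine ⟨rfl, rfl, ?_, ?_, ?_, ?_, ?_⟩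
  · exact (reindexHom_wk rfl rfl y.f y.f_disp).symm
  · exact (reindexHom_wk rfl rfl y.s y.s_disp).symm
  · exact (reindexHom_wk rfl rfl y.r y.r_disp).symm
  · unfold HIsoData.reindex
    rw [homotopyOfTerm_var]
  · unfold HIsoData.reindex
    rw [homotopyOfTerm_var]

/-- The presheaf sending `Γ` to the set of `HIsoData` in context `Γ`. -/
def hIsoPresheaf (I : PreId P) : Cᵒᵖ ⥤ Type v where
  obj Γ := HIsoData I Γ.unop
  map σ := ↾(HIsoData.reindex σ.unop)
  map_id Γ := by
    ext x
    exact (HIsoData.isReindexing (𝟙 _) x).unique (IsReindexing.refl x)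
  map_comp σ τ := by
    ext x
    exact (HIsoData.isReindexing _ x).unique
      ((HIsoData.isReindexing τ.unop _).comp (HIsoData.isReindexing σ.unop x))

lemma reindexHom_iff {Γ Γ' Δ : C} {σ : Γ' ⟶ Γ} {A B : Γ ⟶ P.Ty} {A₁ B₁ : Γ' ⟶ P.Ty}
    (hA : σ ≫ A = A₁) (hB : σ ≫ B = B₁) (f : P.ext A ⟶ P.ext B) (hf : f ≫ P.disp B = P.disp A)
    {g : Δ ⟶ Γ'} {A' B' : Δ ⟶ P.Ty} (hA' : g ≫ A₁ = A') (hB' : g ≫ B₁ = B')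
    {τ : Δ ⟶ Γ} (hτ : g ≫ σ = τ) (hA'' : τ ≫ A = A') (hB'' : τ ≫ B = B')
    (x : P.ext A' ⟶ P.ext B') (hx : x ≫ P.disp B' = P.disp A') :
    P.wk hA' ≫ reindexHom hA hB f hf = x ≫ P.wk hB' ↔ P.wk hA'' ≫ f = x ≫ P.wk hB'' := by
  subst hτ
  have eA := wk_wk hA hA' hA''
  have eB := wk_wk hB hB' hB''
  constructor
  · intro h
    rw [← eA, ← eB, Category.assoc, ← reindexHom_wk hA hB f hf, ← reassoc_of% h]
  · intro h
    apply hom_eq_of_wk hB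
    · rw [Category.assoc, reindexHom_disp, wk_disp, Category.assoc, wk_disp, reassoc_of% hx]
    · rw [Category.assoc, reindexHom_wk hA hB f hf, Category.assoc, ← Category.assoc, eA, eB, h]

/-- For `A, B : R ⟶ Ty`, there is an object over `R` classifying the maps from `A` to `B`. -/
lemma exists_homs {R : C} (A B : R ⟶ P.Ty) :
    ∃ (S : C) (p : S ⟶ R) (f : P.ext (p ≫ A) ⟶ P.ext (p ≫ B))
      (_ : f ≫ P.disp (p ≫ B) = P.disp (p ≫ A)),
      (∀ {Δ : C} (g g' : Δ ⟶ S) (A' B' : Δ ⟶ P.Ty) (hA : g ≫ p ≫ A = A') (hB : g ≫ p ≫ B = B')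
        (hA' : g' ≫ p ≫ A = A') (hB' : g' ≫ p ≫ B = B') (x : P.ext A' ⟶ P.ext B'),
        g ≫ p = g' ≫ p → P.wk hA ≫ f = x ≫ P.wk hB → P.wk hA' ≫ f = x ≫ P.wk hB' → g = g') ∧
      (∀ {Δ : C} (σ : Δ ⟶ R) (A' B' : Δ ⟶ P.Ty) (_ : σ ≫ A = A') (_ : σ ≫ B = B')
        (x : P.ext A' ⟶ P.ext B'), x ≫ P.disp B' = P.disp A' →
        ∃ g : Δ ⟶ S, g ≫ p = σ ∧ ∀ (hA' : g ≫ p ≫ A = A') (hB' : g ≫ p ≫ B = B'),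
          P.wk hA' ≫ f = x ≫ P.wk hB') := by
  obtain ⟨S, p, τ, hτ, huniq, hex⟩ := exists_sections A (P.disp A ≫ B)
  have hτ' : P.disp (p ≫ A) ≫ p ≫ B = τ ≫ P.map := by
    rw [hτ, ← Category.assoc, ← Category.assoc, wk_disp]
  let f : P.ext (p ≫ A) ⟶ P.ext (p ≫ B) := ChosenPullbacksAlong.lift (P.disp _) τ hτ'
  have hf : f ≫ P.disp (p ≫ B) = P.disp (p ≫ A) := ChosenPullbacksAlong.lift_fst _ _ hτ'
  have hv : f ≫ P.var (p ≫ B) = τ := ChosenPullbacksAlong.lift_snd _ _ hτ'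
  refine ⟨S, p, f, hf, ?_, ?_⟩
  · intro Δ g g' A' B' hA hB hA' hB' x hp h h'
    apply huniq g g' A' hA hA' hp
    rw [← hv, reassoc_of% h, reassoc_of% h', wk_var, wk_var]
  · intro Δ σ A' B' hA hB x hx
    obtain ⟨g, hg, hg'⟩ := hex σ A' hA (x ≫ P.var B') (by
      rw [Category.assoc, ← ChosenPullbacksAlong.condition, reassoc_of% hx, ← Category.assoc (P.wk hA),
        wk_disp, Category.assoc, hB])
    refine ⟨g, hg, fun hA' hB' => ?_⟩
    apply ext_hom
    · rw [Category.assoc, hf, wk_disp, Category.assoc, wk_disp, reassoc_of% hx]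
    · rw [Category.assoc, hv, hg' hA', Category.assoc, wk_var]

/-- There is a universal instance of `HIsoData`. -/
lemma exists_universal (I : PreId P) :
    ∃ (R : C) (D : HIsoData I R),
      (∀ {Δ : C} (x : HIsoData I Δ), ∃ g : Δ ⟶ R, IsReindexing g x D) ∧
      (∀ {Δ : C} (x : HIsoData I Δ) (g g' : Δ ⟶ R),
        IsReindexing g x D → IsReindexing g' x D → g = g') := by
  obtain ⟨S₁, p₁, f₁, f₁d, uniq₁, ex₁⟩ :=
    exists_homs (prod.fst : P.Ty ⨯ P.Ty ⟶ P.Ty) (prod.snd : P.Ty ⨯ P.Ty ⟶ P.Ty)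
  obtain ⟨S₂, p₂, s₂, s₂d, uniq₂, ex₂⟩ :=
    exists_homs (p₁ ≫ (prod.snd : P.Ty ⨯ P.Ty ⟶ P.Ty)) (p₁ ≫ prod.fst)
  obtain ⟨S₃, p₃, r₃, r₃d, uniq₃, ex₃⟩ :=
    exists_homs (p₂ ≫ p₁ ≫ (prod.snd : P.Ty ⨯ P.Ty ⟶ P.Ty)) (p₂ ≫ p₁ ≫ prod.fst)
  obtain ⟨A₃, hA₃⟩ : ∃ A₃ : S₃ ⟶ P.Ty, p₃ ≫ p₂ ≫ p₁ ≫ prod.fst = A₃ := ⟨_, rfl⟩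
  obtain ⟨B₃, hB₃⟩ : ∃ B₃ : S₃ ⟶ P.Ty, p₃ ≫ p₂ ≫ p₁ ≫ prod.snd = B₃ := ⟨_, rfl⟩
  have qA : (p₃ ≫ p₂) ≫ p₁ ≫ prod.fst = A₃ := by rw [Category.assoc, hA₃]
  have qB : (p₃ ≫ p₂) ≫ p₁ ≫ prod.snd = B₃ := by rw [Category.assoc, hB₃]
  let f₃ := reindexHom qA qB f₁ f₁d
  have f₃d : f₃ ≫ P.disp B₃ = P.disp A₃ := reindexHom_disp _ _ _ _
  let s₃ := reindexHom hB₃ hA₃ s₂ s₂d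
  have s₃d : s₃ ≫ P.disp A₃ = P.disp B₃ := reindexHom_disp _ _ _ _
  let r₃' := reindexHom (σ := 𝟙 S₃) ((Category.id_comp _).trans hB₃)
    ((Category.id_comp _).trans hA₃) r₃ r₃d
  have r₃d' : r₃' ≫ P.disp A₃ = P.disp B₃ := reindexHom_disp _ _ _ _
  have t₃ : (f₃ ≫ s₃) ≫ P.disp A₃ = 𝟙 _ ≫ P.disp A₃ := by
    rw [Category.assoc, s₃d, f₃d, Category.id_comp]
  obtain ⟨S₄, p₄, τ₄, hτ₄, uniq₄, ex₄⟩ := exists_sections A₃ (idTy I A₃ (f₃ ≫ s₃) t₃)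
  have t₄ : (r₃' ≫ f₃) ≫ P.disp B₃ = 𝟙 _ ≫ P.disp B₃ := by
    rw [Category.assoc, f₃d, r₃d', Category.id_comp]
  obtain ⟨S₅, p₅, τ₅, hτ₅, uniq₅, ex₅⟩ :=
    exists_sections (p₄ ≫ B₃) (P.wk rfl ≫ idTy I B₃ (r₃' ≫ f₃) t₄)
  have kA : (p₅ ≫ p₄) ≫ A₃ = p₅ ≫ p₄ ≫ A₃ := Category.assoc _ _ _
  have kB : (p₅ ≫ p₄) ≫ B₃ = p₅ ≫ p₄ ≫ B₃ := Category.assoc _ _ _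
  have dA : (reindexHom kA kB f₃ f₃d ≫ reindexHom kB kA s₃ s₃d) ≫ P.disp (p₅ ≫ p₄ ≫ A₃) =
      𝟙 _ ≫ P.disp (p₅ ≫ p₄ ≫ A₃) := by simp
  have dB : (reindexHom kB kA r₃' r₃d' ≫ reindexHom kA kB f₃ f₃d) ≫ P.disp (p₅ ≫ p₄ ≫ B₃) =
      𝟙 _ ≫ P.disp (p₅ ≫ p₄ ≫ B₃) := by simp
  have wHs : (P.wk rfl ≫ τ₄) ≫ P.map = idTy I (p₅ ≫ p₄ ≫ A₃) _ dA := by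
    rw [Category.assoc, hτ₄]
    exact (wk_wk_assoc rfl rfl kA _).trans (wk_idTy _ _ _ _ _ (wk_comp_reindexHom _ _ _ _ _ _))
  have wHr : τ₅ ≫ P.map = idTy I (p₅ ≫ p₄ ≫ B₃) _ dB := by
    rw [hτ₅]
    exact (wk_wk_assoc rfl rfl kB _).trans (wk_idTy _ _ _ _ _ (wk_comp_reindexHom _ _ _ _ _ _))
  let D : HIsoData I S₅ :=
    { A := p₅ ≫ p₄ ≫ A₃
      B := p₅ ≫ p₄ ≫ B₃
      f := reindexHom kA kB f₃ f₃d
      s := reindexHom kB kA s₃ s₃d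
      r := reindexHom kB kA r₃' r₃d'
      f_disp := reindexHom_disp _ _ _ _
      s_disp := reindexHom_disp _ _ _ _
      r_disp := reindexHom_disp _ _ _ _
      Hs := homotopyOfTerm _ wHs
      Hr := homotopyOfTerm _ wHr }
  have DHs : D.Hs.hom ≫ P.var _ = P.wk rfl ≫ τ₄ := homotopyOfTerm_var _ wHs
  have DHr : D.Hr.hom ≫ P.var _ = τ₅ := homotopyOfTerm_var _ wHr
  refine ⟨S₅, D, ?_, ?_⟩
  · intro Δ x
    let σ₀ : Δ ⟶ P.Ty ⨯ P.Ty := prod.lift x.A x.B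
    have hA₀ : σ₀ ≫ prod.fst = x.A := prod.lift_fst _ _
    have hB₀ : σ₀ ≫ prod.snd = x.B := prod.lift_snd _ _
    obtain ⟨g₁, e₁, c₁⟩ := ex₁ σ₀ x.A x.B hA₀ hB₀ x.f x.f_disp
    have hA₁ : g₁ ≫ p₁ ≫ prod.fst = x.A := by rw [← Category.assoc, e₁, hA₀]
    have hB₁ : g₁ ≫ p₁ ≫ prod.snd = x.B := by rw [← Category.assoc, e₁, hB₀]
    obtain ⟨g₂, e₂, c₂⟩ := ex₂ g₁ x.B x.A hB₁ hA₁ x.s x.s_disp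
    have hA₂ : g₂ ≫ p₂ ≫ p₁ ≫ prod.fst = x.A := by rw [← Category.assoc, e₂, hA₁]
    have hB₂ : g₂ ≫ p₂ ≫ p₁ ≫ prod.snd = x.B := by rw [← Category.assoc, e₂, hB₁]
    obtain ⟨g₃, e₃, c₃⟩ := ex₃ g₂ x.B x.A hB₂ hA₂ x.r x.r_disp
    have hA₃' : g₃ ≫ p₃ ≫ p₂ ≫ p₁ ≫ prod.fst = x.A := by rw [← Category.assoc, e₃, hA₂]
    have hB₃' : g₃ ≫ p₃ ≫ p₂ ≫ p₁ ≫ prod.snd = x.B := by rw [← Category.assoc, e₃, hB₂]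
    have hA₃'' : g₃ ≫ A₃ = x.A := by rw [← hA₃, hA₃']
    have hB₃'' : g₃ ≫ B₃ = x.B := by rw [← hB₃, hB₃']
    have f_eq : P.wk hA₃'' ≫ f₃ = x.f ≫ P.wk hB₃'' :=
      (reindexHom_iff qA qB f₁ f₁d hA₃'' hB₃'' (τ := g₁) (by rw [← Category.assoc, e₃, e₂])
        hA₁ hB₁ x.f x.f_disp).2 (c₁ hA₁ hB₁)
    have s_eq : P.wk hB₃'' ≫ s₃ = x.s ≫ P.wk hA₃'' :=
      (reindexHom_iff hB₃ hA₃ s₂ s₂d hB₃'' hA₃'' e₃ hB₂ hA₂ x.s x.s_disp).2 (c₂ hB₂ hA₂)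
    have r_eq : P.wk hB₃'' ≫ r₃' = x.r ≫ P.wk hA₃'' :=
      (reindexHom_iff _ _ r₃ r₃d hB₃'' hA₃'' (Category.comp_id _) hB₃' hA₃' x.r x.r_disp).2
        (c₃ hB₃' hA₃')
    obtain ⟨g₄, e₄, c₄⟩ := ex₄ g₃ x.A hA₃'' (x.Hs.hom ≫ P.var _) (by
      rw [homotopy_var]
      refine (wk_idTy _ _ _ _ _ ?_).symm
      rw [← Category.assoc, f_eq, Category.assoc, s_eq, Category.assoc])
    have hA₄ : g₄ ≫ p₄ ≫ A₃ = x.A := by rw [← Category.assoc, e₄, hA₃'']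
    have hB₄ : g₄ ≫ p₄ ≫ B₃ = x.B := by rw [← Category.assoc, e₄, hB₃'']
    obtain ⟨g₅, e₅, c₅⟩ := ex₅ g₄ x.B hB₄ (x.Hr.hom ≫ P.var _) (by
      rw [homotopy_var]
      refine ((wk_wk_assoc rfl hB₄ (by rw [e₄, hB₃'']) _).trans (wk_idTy _ _ _ _ _ ?_)).symm
      obtain rfl := e₄
      rw [← Category.assoc, r_eq, Category.assoc, f_eq, Category.assoc])
    have hA₅ : g₅ ≫ p₅ ≫ p₄ ≫ A₃ = x.A := by rw [← Category.assoc, e₅, hA₄]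
    have hB₅ : g₅ ≫ p₅ ≫ p₄ ≫ B₃ = x.B := by rw [← Category.assoc, e₅, hB₄]
    have e : g₅ ≫ p₅ ≫ p₄ = g₃ := by rw [← Category.assoc, e₅, e₄]
    refine ⟨g₅, hA₅, hB₅, ?_, ?_, ?_, ?_, ?_⟩
    · exact (reindexHom_iff kA kB f₃ f₃d hA₅ hB₅ e hA₃'' hB₃'' x.f x.f_disp).2 f_eq
    · exact (reindexHom_iff kB kA s₃ s₃d hB₅ hA₅ e hB₃'' hA₃'' x.s x.s_disp).2 s_eq
    · exact (reindexHom_iff kB kA r₃' r₃d' hB₅ hA₅ e hB₃'' hA₃'' x.r x.r_disp).2 r_eq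
    · rw [DHs, ← Category.assoc, wk_wk rfl hA₅ (by rw [e₅, hA₄])]
      obtain rfl := e₅
      exact c₄ hA₄
    · rw [DHr]
      exact c₅ hB₅
  · intro Δ x g g' ⟨hA, hB, hf, hs, hr, hHs, hHr⟩ ⟨hA', hB', hf', hs', hr', hHs', hHr'⟩
    have key : ∀ g : Δ ⟶ S₅, ∀ (hA : g ≫ D.A = x.A) (hB : g ≫ D.B = x.B)
        (hf : P.wk hA ≫ D.f = x.f ≫ P.wk hB) (hs : P.wk hB ≫ D.s = x.s ≫ P.wk hA)
        (hr : P.wk hB ≫ D.r = x.r ≫ P.wk hA),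
        ∃ (hA₁ : (g ≫ p₅ ≫ p₄ ≫ p₃ ≫ p₂) ≫ p₁ ≫ prod.fst = x.A)
          (hB₁ : (g ≫ p₅ ≫ p₄ ≫ p₃ ≫ p₂) ≫ p₁ ≫ prod.snd = x.B)
          (hA₂ : (g ≫ p₅ ≫ p₄ ≫ p₃) ≫ p₂ ≫ p₁ ≫ prod.fst = x.A)
          (hB₂ : (g ≫ p₅ ≫ p₄ ≫ p₃) ≫ p₂ ≫ p₁ ≫ prod.snd = x.B)
          (hA₃ : (g ≫ p₅ ≫ p₄) ≫ p₃ ≫ p₂ ≫ p₁ ≫ prod.fst = x.A)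
          (hB₃ : (g ≫ p₅ ≫ p₄) ≫ p₃ ≫ p₂ ≫ p₁ ≫ prod.snd = x.B),
          P.wk hA₁ ≫ f₁ = x.f ≫ P.wk hB₁ ∧ P.wk hB₂ ≫ s₂ = x.s ≫ P.wk hA₂ ∧
          P.wk hB₃ ≫ r₃ = x.r ≫ P.wk hA₃ := by
      intro g hA hB hf hs hr
      have mA : (g ≫ p₅ ≫ p₄) ≫ A₃ = x.A := by rw [← hA]; simp [D]
      have mB : (g ≫ p₅ ≫ p₄) ≫ B₃ = x.B := by rw [← hB]; simp [D]
      have hf₃ := (reindexHom_iff kA kB f₃ f₃d hA hB rfl mA mB x.f x.f_disp).1 hf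
      have hs₃ := (reindexHom_iff kB kA s₃ s₃d hB hA rfl mB mA x.s x.s_disp).1 hs
      have hr₃ := (reindexHom_iff kB kA r₃' r₃d' hB hA rfl mB mA x.r x.r_disp).1 hr
      have hA₁ : (g ≫ p₅ ≫ p₄ ≫ p₃ ≫ p₂) ≫ p₁ ≫ prod.fst = x.A := by
        rw [← mA, ← hA₃]; simp only [Category.assoc]
      have hB₁ : (g ≫ p₅ ≫ p₄ ≫ p₃ ≫ p₂) ≫ p₁ ≫ prod.snd = x.B := by
        rw [← mB, ← hB₃]; simp only [Category.assoc]
      have hA₂ : (g ≫ p₅ ≫ p₄ ≫ p₃) ≫ p₂ ≫ p₁ ≫ prod.fst = x.A := by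
        rw [← hA₁]; simp only [Category.assoc]
      have hB₂ : (g ≫ p₅ ≫ p₄ ≫ p₃) ≫ p₂ ≫ p₁ ≫ prod.snd = x.B := by
        rw [← hB₁]; simp only [Category.assoc]
      have nA : (g ≫ p₅ ≫ p₄) ≫ p₃ ≫ p₂ ≫ p₁ ≫ prod.fst = x.A := by
        rw [← hA₁]; simp only [Category.assoc]
      have nB : (g ≫ p₅ ≫ p₄) ≫ p₃ ≫ p₂ ≫ p₁ ≫ prod.snd = x.B := by
        rw [← hB₁]; simp only [Category.assoc]
      refine ⟨hA₁, hB₁, hA₂, hB₂, nA, nB, ?_, ?_, ?_⟩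
      · exact (reindexHom_iff qA qB f₁ f₁d mA mB (by simp only [Category.assoc]) hA₁ hB₁
          x.f x.f_disp).1 hf₃
      · exact (reindexHom_iff hB₃ hA₃ s₂ s₂d mB mA (by simp only [Category.assoc]) hB₂ hA₂
          x.s x.s_disp).1 hs₃
      · exact (reindexHom_iff _ _ r₃ r₃d mB mA (Category.comp_id _) nB nA x.r x.r_disp).1 hr₃
    obtain ⟨a₁, b₁, a₂, b₂, a₃, b₃, hf₁, hs₂, hr₃⟩ := key g hA hB hf hs hr
    obtain ⟨a₁', b₁', a₂', b₂', a₃', b₃', hf₁', hs₂', hr₃'⟩ := key g' hA' hB' hf' hs' hr'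
    have e₀ : (g ≫ p₅ ≫ p₄ ≫ p₃ ≫ p₂) ≫ p₁ = (g' ≫ p₅ ≫ p₄ ≫ p₃ ≫ p₂) ≫ p₁ := by
      apply Limits.prod.hom_ext
      · rw [Category.assoc _ p₁, Category.assoc _ p₁, a₁, a₁']
      · rw [Category.assoc _ p₁, Category.assoc _ p₁, b₁, b₁']
    have e₁ : g ≫ p₅ ≫ p₄ ≫ p₃ ≫ p₂ = g' ≫ p₅ ≫ p₄ ≫ p₃ ≫ p₂ :=
      uniq₁ _ _ x.A x.B a₁ b₁ a₁' b₁' x.f e₀ hf₁ hf₁'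
    have e₂ : g ≫ p₅ ≫ p₄ ≫ p₃ = g' ≫ p₅ ≫ p₄ ≫ p₃ :=
      uniq₂ _ _ x.B x.A b₂ a₂ b₂' a₂' x.s (by simpa only [Category.assoc] using e₁) hs₂ hs₂'
    have e₃ : g ≫ p₅ ≫ p₄ = g' ≫ p₅ ≫ p₄ :=
      uniq₃ _ _ x.B x.A b₃ a₃ b₃' a₃' x.r (by simpa only [Category.assoc] using e₂) hr₃ hr₃'
    have e₄ : g ≫ p₅ = g' ≫ p₅ := by
      have n : (g ≫ p₅) ≫ p₄ ≫ A₃ = x.A := by rw [← hA, Category.assoc]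
      have n' : (g' ≫ p₅) ≫ p₄ ≫ A₃ = x.A := by rw [← hA', Category.assoc]
      refine uniq₄ _ _ x.A n n' (by simpa only [Category.assoc] using e₃) ?_
      rw [← wk_wk rfl hA n, ← wk_wk rfl hA' n', Category.assoc, Category.assoc, ← DHs, hHs, hHs']
    refine uniq₅ _ _ x.B hB hB' e₄ ?_
    rw [← DHr, hHr, hHr']

instance hIsoPresheaf_isRepresentable (I : PreId P) : (hIsoPresheaf I).IsRepresentable := by
  obtain ⟨R, D, ex, uniq⟩ := exists_universal I
  have e : ∀ {Δ : C} (g : Δ ⟶ R), (hIsoPresheaf I).map g.op D = D.reindex g := fun _ => rfl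
  refine ⟨R, ⟨{
    homEquiv := fun {Δ} => Equiv.ofBijective (fun g : Δ ⟶ R => D.reindex g) ⟨?_, ?_⟩
    homEquiv_comp := ?_ }⟩⟩
  · intro g g' (h : D.reindex g = D.reindex g')
    exact uniq _ g g' (D.isReindexing g) (h ▸ D.isReindexing g')
  · intro x
    obtain ⟨g, hg⟩ := ex x
    exact ⟨g, (D.isReindexing g).unique hg⟩
  · intro Δ Δ' h g
    exact (D.isReindexing (h ≫ g)).unique
      (((D.reindex g).isReindexing h).comp (D.isReindexing g))

end Reindexing

section HIso

variable {P : UniversalMap C} (I : PreId P)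

/-- The generic object of `Id`-homotopy isomorphisms: an object representing `hIsoPresheaf`. -/
def HIso : C := (hIsoPresheaf I).reprX

/-- The universal property of `HIso`. -/
def hIsoRepr : (hIsoPresheaf I).RepresentableBy (HIso I) := (hIsoPresheaf I).representableBy

/-- The generic homotopy isomorphism. -/
def genericHIso : HIsoData I (HIso I) := (hIsoRepr I).homEquiv (𝟙 (HIso I))

/-- The source map, representing `(A, B, f, s, r, Hs, Hr) ↦ A`. -/
def src : HIso I ⟶ P.Ty := (genericHIso I).A

/-- The target map, representing `(A, B, f, s, r, Hs, Hr) ↦ B`. -/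
def tgt : HIso I ⟶ P.Ty := (genericHIso I).B

/-- The identity of a type, as a homotopy isomorphism with reflexivity homotopies. -/
def trivialHIso {Γ : C} (A : Γ ⟶ P.Ty) : HIsoData I Γ where
  A := A
  B := A
  f := 𝟙 _
  s := 𝟙 _
  r := 𝟙 _
  f_disp := Category.id_comp _
  s_disp := Category.id_comp _
  r_disp := Category.id_comp _
  Hs := ⟨I.refl _, by simp [pullback.diagonal]⟩
  Hr := ⟨I.refl _, by simp [pullback.diagonal]⟩

/-- The map classifying trivial homotopy isomorphisms, representing `A ↦ trivialHIso A`. -/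
def trv : P.Ty ⟶ HIso I := (hIsoRepr I).homEquiv.symm (trivialHIso I (𝟙 P.Ty))

lemma reindex_genericHIso_trv : (genericHIso I).reindex (trv I) = trivialHIso I (𝟙 P.Ty) := by
  have h := (hIsoRepr I).homEquiv_comp (trv I) (𝟙 (HIso I))
  rw [Category.comp_id] at h
  exact h.symm.trans ((hIsoRepr I).homEquiv.apply_symm_apply _)

lemma trv_src : trv I ≫ src I = 𝟙 P.Ty :=
  congrArg HIsoData.A (reindex_genericHIso_trv I)

lemma trv_tgt : trv I ≫ tgt I = 𝟙 P.Ty :=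
  congrArg HIsoData.B (reindex_genericHIso_trv I)

end HIso

/-! ### Univalence -/

section Univalence

variable (P : UniversalMap C) {P₀ : UniversalMap C} (I₀ : PreId P₀)

/-- A book `P`-univalence structure on a universal map with a pre-`Id`-type structure. -/
structure BookUnivalence where
  fibrancy : Fibrancy P (prod.lift (src I₀) (tgt I₀))
  lifts : UniformLowerLifts (trv I₀) P.map

/-- A pointed `P`-univalence structure on a universal map with a pre-`Id`-type structure. -/
structure PointedUnivalence where
  fibrancy : Fibrancy P (prod.lift (src I₀) (tgt I₀))
  lifts : UniformLifts (trv I₀) P.map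

variable {P I₀}

lemma retract_over {p : HIso I₀ ⟶ P₀.Ty} (hp : trv I₀ ≫ p = 𝟙 P₀.Ty) :
    (p ≫ trv I₀) ≫ p = 𝟙 (HIso I₀) ≫ p := by
  rw [Category.assoc, hp, Category.comp_id, Category.id_comp]

lemma trv_retract {p : HIso I₀ ⟶ P₀.Ty} (hp : trv I₀ ≫ p = 𝟙 P₀.Ty) :
    trv I₀ ≫ p ≫ trv I₀ = trv I₀ ≫ 𝟙 (HIso I₀) := by
  rw [reassoc_of% hp, Category.comp_id]

/-- The square from `trv` to the endpoint map of the fibred identity type of `p`, with upper edge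
`refl ∘ trv` and lower edge `(trv ∘ p, id)`. -/
lemma retractSquare (I : PreId P) {p : HIso I₀ ⟶ P₀.Ty} (hp : trv I₀ ≫ p = 𝟙 P₀.Ty)
    (φ : Fibrancy P p) :
    CommSq (trv I₀ ≫ I.refl φ) (trv I₀) (I.ends φ)
      (pullback.lift (p ≫ trv I₀) (𝟙 (HIso I₀)) (retract_over hp)) where
  w := by
    rw [Category.assoc, PreId.refl_ends]
    apply pullback.hom_ext
    · rw [Category.assoc, Category.assoc, pullback.diagonal_fst, pullback.lift_fst,
        reassoc_of% hp, Category.comp_id]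
    · rw [Category.assoc, Category.assoc, pullback.diagonal_snd, pullback.lift_snd]

end Univalence

end UnivCat

end

/-! The fibrancy half of univalence is automatic. The object of homotopy isomorphisms is a tower of
five stages over `Ty × Ty` that adds `f`, `s`, `r`, `Hs`, `Hr` in turn. Each stage classifies terms
of a type in an extended context, so it is a pullback of `P_π₀(π₀)` and a `π₀`-fibration by `Π₀`.
Since `π₀` is a `π`-fibration, so is every stage, and the `Σ`-structure on `π` composes them. As
`U₀` is fibrant, composing further with the projections of `U₀ × U₀` makes `src` and `tgt`
fibrations. Univalence thus concerns only lifts of `trv` against `π`.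

Lifts give the homotopy because `ev_∂` is a selected pullback of `π`: lifting against `π` implies
lifting against `ev_∂`, and a diagonal of the given square is a homotopy from `trv ∘ p` to the
identity. It is constant along `trv` exactly when the upper triangle also commutes.

Conversely, let `e : E → B` be a fibration with section `s`, and let `H` be a homotopy from `s ∘ e`
to the identity. In a lifting problem of `Y × s` against `π`, the lower edge is a type family `b` on
`Y × E` and the upper edge is a term `a` of `b` over the section. At `(y, x)` the term `a (y, e x)`
has type `b (y, s (e x))`, and transport along `H x` moves it to `b (y, x)`. Classifying the pair `Y
× E → Y × B` and `b` by a map to `P_π(U)` turns this into an instance of generic transport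
(`lowerLifts`). Classification is strictly stable under substitution, so the lifts are uniform.

The upper triangle requires transport along reflexivity to be the identity and `H` to be constant
along `s` (`lifts`). A full `Id`-structure gives such a normal transport by path induction into the
type of functions from the fibre at the first endpoint to the fibre at the second, starting from the
identity function (`JStructure.exists_normal_transport`). This is where the `Π`-structure on `π`
enters. -/

noncomputable section

namespace UnivCat

variable {C : Type u} [Category.{v} C]

/-! ### Base change of fibrations. -/

section FibrancyOps

variable {P : UniversalMap C}

/-- The pullback of a fibration is a fibration. -/
abbrev Fibrancy.ofIsPullback {E B E' B' : C} {e : E ⟶ B} (φ : Fibrancy P e) {e' : E' ⟶ B'}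
    {α : E' ⟶ E} {β : B' ⟶ B} (h : IsPullback α e' e β) : Fibrancy P e' where
  name := β ≫ φ.name
  point := α ≫ φ.point
  isPullback := h.paste_horiz φ.isPullback

/-- A fibration of an internal universe is a fibration of the ambient universal map. -/
def Fibrancy.ofInternal {P₀ : UniversalMap C} (el : Fibrancy P P₀.map) {E B : C} {e : E ⟶ B}
    (φ : Fibrancy P₀ e) : Fibrancy P e :=
  el.ofIsPullback φ.isPullback

variable [HasFiniteLimits C]

/-- The pullback of a fibration along a projection. -/
abbrev Fibrancy.prodLeft {E B : C} {e : E ⟶ B} (φ : Fibrancy P e) (Y : C) :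
    Fibrancy P (prod.map (𝟙 Y) e) :=
  φ.ofIsPullback (α := prod.snd) (β := prod.snd) (by
    refine ⟨⟨(prod.map_snd _ _).symm⟩, ⟨PullbackCone.IsLimit.mk _
      (fun s => prod.lift (s.snd ≫ prod.fst) s.fst) ?_ ?_ ?_⟩⟩
    · intro s
      exact prod.lift_snd _ _
    · intro s
      rw [prod.lift_map, Category.comp_id, s.condition]
      exact (prod.comp_lift _ _ _).symm.trans (by rw [prod.lift_fst_snd, Category.comp_id])
    · intro s m h₁ h₂
      apply Limits.prod.hom_ext
      · rw [prod.lift_fst, ← h₂, Category.assoc, prod.map_fst, Category.comp_id]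
      · rw [prod.lift_snd, h₁])

end FibrancyOps

variable [HasFiniteLimits C]

namespace UniversalMap

variable (P : UniversalMap C)

/-- The generic type family `π^* π_*(Tm × Ty) ⟶ Ty`. -/
abbrev genTy : P.ext (P.polyBase P.Ty) ⟶ P.Ty := P.polyEv P.Ty ≫ prod.snd

end UniversalMap

/-! ### Classification of composable fibrations by `P_π(U)`, and composition by `Σ`. -/

section Classify

variable {P : UniversalMap C}

/-- This is the triangle identity for pullback along `π` and pushforward: transposing `termOver A T`
and composing with the counit returns it. It makes the generic family restrict to the given one
along its classifying map. -/
lemma wk_polyEv {Γ X : C} (A : Γ ⟶ P.Ty) (T : P.ext A ⟶ X) :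
    P.wk (classify_base A T) ≫ P.polyEv X ≫ prod.snd = T := by
  have key := (ExponentiableMorphism.pullbackPushforwardAdj P.map).homEquiv_counit (Over.mk A)
    (Over.mk (prod.fst : P.Tm ⨯ X ⟶ P.Tm))
    ((ExponentiableMorphism.pullbackPushforwardAdj P.map).homEquiv (Over.mk A) _ (termOver A T))
  rw [Equiv.symm_apply_apply] at key
  have h : termOver A T = (ChosenPullbacksAlong.pullback P.map).map
      (Over.homMk (classify A T) (classify_base A T) : Over.mk A ⟶ P.polyOver X) ≫
      (ExponentiableMorphism.pullbackPushforwardAdj P.map).counit.app _ := key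
  have h' := (congr_arg CommaMorphism.left h).trans (Over.comp_left _ _ _ _ _)
  have e := pullback_map_left (P := P) (classify_base A T)
  have h'' : prod.lift (P.var A) T = P.wk (classify_base A T) ≫ P.polyEv X :=
    h'.trans (congrArg (· ≫ P.polyEv X) e)
  rw [← Category.assoc, ← h'', prod.lift_snd]

variable {E B : C} {e : E ⟶ B} (φ : Fibrancy P e)

/-- A fibration is isomorphic to the context extension by its name. -/
def Fibrancy.fromExt : P.ext φ.name ⟶ E :=
  φ.isPullback.lift (P.var φ.name) (P.disp φ.name) ChosenPullbacksAlong.condition.symm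

/-- A fibration is isomorphic to the context extension by its name. -/
def Fibrancy.toExt : E ⟶ P.ext φ.name :=
  ChosenPullbacksAlong.lift e φ.point φ.isPullback.w.symm

lemma Fibrancy.toExt_disp : φ.toExt ≫ P.disp φ.name = e := ChosenPullbacksAlong.lift_fst _ _ _

lemma Fibrancy.toExt_var : φ.toExt ≫ P.var φ.name = φ.point := ChosenPullbacksAlong.lift_snd _ _ _

lemma Fibrancy.fromExt_comp : φ.fromExt ≫ e = P.disp φ.name := φ.isPullback.lift_snd _ _ _

lemma Fibrancy.fromExt_point : φ.fromExt ≫ φ.point = P.var φ.name := φ.isPullback.lift_fst _ _ _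

lemma Fibrancy.toExt_fromExt : φ.toExt ≫ φ.fromExt = 𝟙 E := by
  apply φ.isPullback.hom_ext
  · rw [Category.assoc, fromExt_point, toExt_var, Category.id_comp]
  · rw [Category.assoc, fromExt_comp, toExt_disp, Category.id_comp]

/-- The map classifying a fibration `E ⟶ B` together with a type family on `E`. -/
def Fibrancy.pairClass (b : E ⟶ P.Ty) : B ⟶ P.polyObj P.Ty := classify φ.name (φ.fromExt ≫ b)

/-- The map to the generic fibration over `pairClass`. -/
def Fibrancy.pairTop (b : E ⟶ P.Ty) : E ⟶ P.ext (P.polyBase P.Ty) :=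
  φ.toExt ≫ P.wk (classify_base φ.name (φ.fromExt ≫ b))

lemma Fibrancy.pairTop_disp (b : E ⟶ P.Ty) :
    φ.pairTop b ≫ P.disp (P.polyBase P.Ty) = e ≫ φ.pairClass b := by
  rw [pairTop, Category.assoc, wk_disp, ← Category.assoc, toExt_disp, pairClass]

lemma Fibrancy.pairTop_var (b : E ⟶ P.Ty) :
    φ.pairTop b ≫ P.var (P.polyBase P.Ty) = φ.point := by
  rw [pairTop, Category.assoc, wk_var, toExt_var]

lemma Fibrancy.pairTop_genTy (b : E ⟶ P.Ty) : φ.pairTop b ≫ P.genTy = b := by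
  rw [pairTop, Category.assoc, wk_polyEv, ← Category.assoc, toExt_fromExt, Category.id_comp]

variable {φ}

/-- The comparison maps `fromExt` are determined by point and base, both of which `α` and `β`
preserve. Naturality is therefore an equality, which is what uniformity of the lifts later rests on.
-/
lemma Fibrancy.comp_pairClass {E' B' : C} {e' : E' ⟶ B'} {φ' : Fibrancy P e'} {α : E' ⟶ E}
    {β : B' ⟶ B} (hn : β ≫ φ.name = φ'.name) (hp : α ≫ φ.point = φ'.point)
    (hw : α ≫ e = e' ≫ β) (b : E ⟶ P.Ty) :
    β ≫ φ.pairClass b = φ'.pairClass (α ≫ b) := by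
  rw [pairClass, pairClass, comp_classify hn]
  congr 1
  rw [← Category.assoc, ← Category.assoc]
  congr 1
  apply φ.isPullback.hom_ext
  · rw [Category.assoc, fromExt_point, wk_var, Category.assoc, hp, fromExt_point]
  · rw [Category.assoc, fromExt_comp, wk_disp, Category.assoc, hw, ← Category.assoc, fromExt_comp]

lemma Fibrancy.comp_pairTop {E' B' : C} {e' : E' ⟶ B'} {φ' : Fibrancy P e'} {α : E' ⟶ E}
    {β : B' ⟶ B} (hn : β ≫ φ.name = φ'.name) (hp : α ≫ φ.point = φ'.point)
    (hw : α ≫ e = e' ≫ β) (b : E ⟶ P.Ty) :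
    α ≫ φ.pairTop b = φ'.pairTop (α ≫ b) := by
  apply ext_hom
  · rw [Category.assoc, pairTop_disp, pairTop_disp, ← comp_pairClass hn hp hw, reassoc_of% hw]
  · rw [Category.assoc, pairTop_var, pairTop_var, hp]

lemma pairClass_base (b : E ⟶ P.Ty) : φ.pairClass b ≫ P.polyBase P.Ty = φ.name :=
  classify_base _ _

/-- Pasting with the selected square of `polyBase` gives back the fibrancy square of `e`, so the
left square is a pullback by cancellation. -/
lemma Fibrancy.pairTop_isPullback (b : E ⟶ P.Ty) :
    IsPullback (φ.pairTop b) e (P.disp (P.polyBase P.Ty)) (φ.pairClass b) := by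
  refine IsPullback.of_right (h₁₂ := P.var (P.polyBase P.Ty)) (h₂₂ := P.polyBase P.Ty)
    (v₁₃ := P.map) ?_ (φ.pairTop_disp b) (Fibrancy.canonical P (P.polyBase P.Ty)).isPullback
  rw [pairTop_var, pairClass_base]
  exact φ.isPullback

/-- The composite of two fibrations is a fibration, given a `Σ`-type structure. -/
def Fibrancy.comp (σ : SigmaStructure P) {F : C} {f : F ⟶ E} (ψ : Fibrancy P f)
    (φ : Fibrancy P e) : Fibrancy P (f ≫ e) :=
  have h : (f ≫ φ.pairTop ψ.name) ≫ P.genTy = ψ.point ≫ P.map := by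
    rw [Category.assoc, φ.pairTop_genTy, ψ.isPullback.w]
  Fibrancy.ofIsPullback σ
    (α := ChosenPullbacksAlong.lift (f ≫ φ.pairTop ψ.name) ψ.point h)
    (β := φ.pairClass ψ.name) (by
      -- The two fibrations are pulled back separately from the two factors of the generic
      -- composite; for the upper one, cancellation against the selected pullback along `genTy`
      -- leaves the fibrancy square of `f`.
      refine IsPullback.paste_vert ?_ (φ.pairTop_isPullback ψ.name)
      refine IsPullback.of_right (h₁₂ := P.var P.genTy) (h₂₂ := P.genTy) (v₁₃ := P.map) ?_
        (ChosenPullbacksAlong.lift_fst _ _ h) (Fibrancy.canonical P P.genTy).isPullback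
      rw [ChosenPullbacksAlong.lift_snd _ _ h, φ.pairTop_genTy]
      exact ψ.isPullback)

end Classify

/-! ### Transport along identity types. -/

namespace PreId

variable {P : UniversalMap C} {I : PreId P}

/-- The generic fibred identity type `Id_B(E)` for `E ⟶ B = π_*(Tm × Ty)`. -/
abbrev genPath (I : PreId P) : C := I.obj (Fibrancy.canonical P (P.polyBase P.Ty))

namespace TransportStructure

variable (T : I.TransportStructure)

/-- Transport of a term along a generalized path. -/
def app {W : C} (k : W ⟶ I.genPath) (t : W ⟶ P.Tm)
    (h : t ≫ P.map = k ≫ I.ev₀ _ ≫ P.genTy) : W ⟶ P.Tm :=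
  pullback.lift k (ChosenPullbacksAlong.lift (k ≫ I.ev₀ _) t (by rw [Category.assoc, h]))
    (ChosenPullbacksAlong.lift_fst _ _ _).symm ≫ T.map ≫ pullback.snd _ _ ≫ P.var P.genTy

lemma app_map {W : C} (k : W ⟶ I.genPath) (t : W ⟶ P.Tm)
    (h : t ≫ P.map = k ≫ I.ev₀ _ ≫ P.genTy) :
    T.app k t h ≫ P.map = k ≫ I.ev₁ _ ≫ P.genTy := by
  rw [app]
  simp only [Category.assoc]
  rw [← ChosenPullbacksAlong.condition]
  have := pullback.condition (f := I.ev₁ (Fibrancy.canonical P (P.polyBase P.Ty))) (g := P.genFib)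
  rw [← reassoc_of% this, reassoc_of% T.w, pullback.lift_fst_assoc]

lemma comp_app {W W' : C} (σ : W' ⟶ W) (k : W ⟶ I.genPath) (t : W ⟶ P.Tm)
    (h : t ≫ P.map = k ≫ I.ev₀ _ ≫ P.genTy)
    {k' : W' ⟶ I.genPath} {t' : W' ⟶ P.Tm} (h' : t' ≫ P.map = k' ≫ I.ev₀ _ ≫ P.genTy)
    (hk : σ ≫ k = k') (ht : σ ≫ t = t') : σ ≫ T.app k t h = T.app k' t' h' := by
  subst hk ht
  rw [app, app, ← Category.assoc]
  congr 1
  apply pullback.hom_ext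
  · rw [Category.assoc, pullback.lift_fst, pullback.lift_fst]
  · rw [Category.assoc, pullback.lift_snd, pullback.lift_snd]
    apply ext_hom <;> simp

/-- A transport structure is normal if transport along reflexivity paths is the identity. -/
def Normal : Prop :=
  ∀ {W : C} (m : W ⟶ P.ext (P.polyBase P.Ty)) (t : W ⟶ P.Tm)
    (h : t ≫ P.map = (m ≫ I.refl (Fibrancy.canonical P (P.polyBase P.Ty))) ≫ I.ev₀ _ ≫ P.genTy),
    T.app (m ≫ I.refl _) t h = t

end TransportStructure

/-! ### From a contracting homotopy to uniform lifts of the section. -/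

section Lifts

variable {E B : C} {e : E ⟶ B} {φ : Fibrancy P e} {s : B ⟶ E} {hs : (e ≫ s) ≫ e = 𝟙 E ≫ e}

/-- The points `(y, s (e x))` and `(y, x)` lie in one fibre over `Y × B`, so their images in the
generic fibration can be the endpoints of a path. -/
lemma path_over (φ : Fibrancy P e) (hs : (e ≫ s) ≫ e = 𝟙 E ≫ e) {Y : C} (b : Y ⨯ E ⟶ P.Ty) :
    (prod.map (𝟙 Y) (e ≫ s) ≫ (φ.prodLeft Y).pairTop b) ≫ P.disp (P.polyBase P.Ty) =
      (φ.prodLeft Y).pairTop b ≫ P.disp (P.polyBase P.Ty) := by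
  rw [Category.assoc, Fibrancy.pairTop_disp, ← Category.assoc, prod.map_map, hs,
    Category.id_comp, Category.id_comp]

/-- An identity type depends on its endpoints only through their images in `Tm ×_Ty Tm`. These are
the same for the images in the generic fibration as for the endpoints of `H`, whatever `b` is, so
the term underlying `H` also serves as a path there. -/
lemma Homotopy.path_condition (H : I.Homotopy φ (e ≫ s) (𝟙 E) hs) {Y : C} (b : Y ⨯ E ⟶ P.Ty) :
    pullback.lift _ _ (path_over φ hs b) ≫
        pairMap (Fibrancy.canonical P (P.polyBase P.Ty)) ≫ I.Id =
      (prod.snd ≫ H.hom ≫ P.var (pairMap φ ≫ I.Id)) ≫ P.map := by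
  simp only [Category.assoc, ← ChosenPullbacksAlong.condition]
  rw [reassoc_of% H.w, ← Category.assoc, ← Category.assoc (pullback.lift _ _ hs), ← Category.assoc]
  congr 1
  apply pullback.hom_ext
  · simp [pairMap, pullback.lift_fst, pullback.lift_fst_assoc, Fibrancy.pairTop_var]
  · simp [pairMap, pullback.lift_snd, pullback.lift_snd_assoc, Fibrancy.pairTop_var]

/-- The generalized path in the generic fibration obtained from a homotopy between `e ≫ s` and the
identity and a type family on `Y × E`. -/
def Homotopy.path (H : I.Homotopy φ (e ≫ s) (𝟙 E) hs) {Y : C} (b : Y ⨯ E ⟶ P.Ty) :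
    Y ⨯ E ⟶ I.genPath :=
  ChosenPullbacksAlong.lift _ _ (H.path_condition b)

lemma Homotopy.path_ev₀ (H : I.Homotopy φ (e ≫ s) (𝟙 E) hs) {Y : C} (b : Y ⨯ E ⟶ P.Ty) :
    H.path b ≫ I.ev₀ _ = prod.map (𝟙 Y) (e ≫ s) ≫ (φ.prodLeft Y).pairTop b := by
  rw [← Category.assoc, path, ChosenPullbacksAlong.lift_fst _ _ (H.path_condition b),
    pullback.lift_fst]

lemma Homotopy.path_ev₁ (H : I.Homotopy φ (e ≫ s) (𝟙 E) hs) {Y : C} (b : Y ⨯ E ⟶ P.Ty) :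
    H.path b ≫ I.ev₁ _ = (φ.prodLeft Y).pairTop b := by
  rw [← Category.assoc, path, ChosenPullbacksAlong.lift_fst _ _ (H.path_condition b),
    pullback.lift_snd]

lemma Homotopy.path_var (H : I.Homotopy φ (e ≫ s) (𝟙 E) hs) {Y : C} (b : Y ⨯ E ⟶ P.Ty) :
    H.path b ≫ P.var _ = prod.snd ≫ H.hom ≫ P.var _ :=
  ChosenPullbacksAlong.lift_snd _ _ (H.path_condition b)

lemma obj_hom_ext {W : C} {k k' : W ⟶ I.obj φ} (h₀ : k ≫ I.ev₀ φ = k' ≫ I.ev₀ φ)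
    (h₁ : k ≫ I.ev₁ φ = k' ≫ I.ev₁ φ) (hv : k ≫ P.var _ = k' ≫ P.var _) : k = k' := by
  apply ext_hom _ hv
  apply pullback.hom_ext
  · simpa only [Category.assoc] using h₀
  · simpa only [Category.assoc] using h₁

/-- Endpoints are natural in `Y` by `comp_pairTop`, and the underlying term does not involve `Y`.
This is the source of uniformity. -/
lemma Homotopy.comp_path (H : I.Homotopy φ (e ≫ s) (𝟙 E) hs) {X Y : C} (t : Y ⟶ X)
    (b : X ⨯ E ⟶ P.Ty) :
    prod.map t (𝟙 E) ≫ H.path b = H.path (prod.map t (𝟙 E) ≫ b) := by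
  have h : prod.map t (𝟙 E) ≫ (φ.prodLeft X).pairTop b =
      (φ.prodLeft Y).pairTop (prod.map t (𝟙 E) ≫ b) :=
    Fibrancy.comp_pairTop (β := prod.map t (𝟙 B)) (by simp) (by simp) (by simp) b
  apply obj_hom_ext
  · rw [Category.assoc, H.path_ev₀ _, H.path_ev₀ _, ← h]
    simp
  · rw [Category.assoc, H.path_ev₁ _, H.path_ev₁ _, ← h]
  · rw [Category.assoc, H.path_var, H.path_var]
    simp

lemma refl_ev₀ : I.refl φ ≫ I.ev₀ φ = 𝟙 E := by
  rw [← Category.assoc, refl_ends, pullback.diagonal_fst]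

lemma refl_ev₁ : I.refl φ ≫ I.ev₁ φ = 𝟙 E := by
  rw [← Category.assoc, refl_ends, pullback.diagonal_snd]

/-- On the section both endpoints coincide, and constancy of `H` makes the underlying term the
reflexivity term. Normal transport can then be applied for the upper triangle. -/
lemma Homotopy.section_path (H : I.Homotopy φ (e ≫ s) (𝟙 E) hs) (hse : s ≫ e = 𝟙 B)
    (hc : s ≫ H.hom = (s ≫ e ≫ s) ≫ I.refl φ) {Y : C} (b : Y ⨯ E ⟶ P.Ty) :
    prod.map (𝟙 Y) s ≫ H.path b =
      (prod.map (𝟙 Y) s ≫ (φ.prodLeft Y).pairTop b) ≫ I.refl _ := by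
  apply obj_hom_ext
  · rw [Category.assoc, H.path_ev₀ _, Category.assoc, refl_ev₀, Category.comp_id]
    simp [reassoc_of% hse]
  · rw [Category.assoc, H.path_ev₁ _, Category.assoc, refl_ev₁, Category.comp_id]
  · rw [Category.assoc, H.path_var, prod.map_snd_assoc, reassoc_of% hc, reassoc_of% hse]
    simp only [Category.assoc, refl_var]
    rw [← Category.assoc (Fibrancy.pairTop _ _), Fibrancy.pairTop_var]
    simp

namespace TransportStructure

variable (T : I.TransportStructure) (H : I.Homotopy φ (e ≫ s) (𝟙 E) hs)

lemma lift_aux {Y : C} (a : Y ⨯ B ⟶ P.Tm) (b : Y ⨯ E ⟶ P.Ty)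
    (h : a ≫ P.map = prod.map (𝟙 Y) s ≫ b) :
    (prod.map (𝟙 Y) e ≫ a) ≫ P.map = H.path b ≫ I.ev₀ _ ≫ P.genTy := by
  rw [← Category.assoc (H.path b), H.path_ev₀ b, Category.assoc, Category.assoc,
    Fibrancy.pairTop_genTy, h, ← Category.assoc, prod.map_map, Category.id_comp]

/-- Transport along a homotopy between `e ≫ s` and the identity, where `e` is a fibration, yields
lower-half lifts of `s` against the universal map. -/
def lowerLifts : UniformLowerLifts s P.map where
  -- At `(y, x)` the term `a (y, e x)` has type `b (y, s (e x))`, the fibre at the start of the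
  -- path.
  lift {Y} a b h := T.app (H.path b) (prod.map (𝟙 Y) e ≫ a) (lift_aux H a b h)
  lower a b h := by
    rw [app_map, ← Category.assoc, H.path_ev₁ b, Fibrancy.pairTop_genTy]
  uniform t a b h h' :=
    (T.comp_app _ _ _ _ _ (H.comp_path t b) (by simp)).symm

/-- Normal transport along a homotopy constant on the section `s` yields lifts of `s` against the
universal map. -/
def lifts (hT : T.Normal) (hse : s ≫ e = 𝟙 B) (hc : s ≫ H.hom = (s ≫ e ≫ s) ≫ I.refl φ) :
    UniformLifts s P.map where
  lift := (T.lowerLifts H).lift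
  lower := (T.lowerLifts H).lower
  uniform := (T.lowerLifts H).uniform
  upper {Y} a b h := by
    have h' : a ≫ P.map = ((prod.map (𝟙 Y) s ≫ (φ.prodLeft Y).pairTop b) ≫
        I.refl (Fibrancy.canonical P (P.polyBase P.Ty))) ≫ I.ev₀ _ ≫ P.genTy := by
      rw [Category.assoc, ← Category.assoc (I.refl _), refl_ev₀, Category.id_comp, Category.assoc,
        Fibrancy.pairTop_genTy, h]
    -- Restriction along `Y × s` turns the path into reflexivity and, since `e ∘ s` is the identity,
    -- the transported term into `a`.
    refine (T.comp_app (prod.map (𝟙 Y) s) (H.path b) _ (lift_aux H a b h) h'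
      (H.section_path hse hc b) ?_).trans (hT _ _ _)
    rw [← Category.assoc, prod.map_map, hse]
    simp

end TransportStructure

end Lifts

end PreId

/-! ### Path induction and normal transport. -/

namespace PreId

variable {P : UniversalMap C} {I : PreId P}

lemma genRefl_var : I.genRefl ≫ P.var I.Id = I.reflName :=
  ChosenPullbacksAlong.lift_snd _ _ I.w.symm

/-- Path induction: a section, over the reflexivity paths in a type `A`, of a type family on
`Id_Γ(Γ.A)` extends to all of `Id_Γ(Γ.A)`. -/
lemma JStructure.exists_elim (J : I.JStructure) {Γ : C} (A : Γ ⟶ P.Ty)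
    (T : I.obj (Fibrancy.canonical P A) ⟶ P.Ty) (d : P.ext A ⟶ P.Tm)
    (h : d ≫ P.map = I.refl (Fibrancy.canonical P A) ≫ T) :
    ∃ j : I.obj (Fibrancy.canonical P A) ⟶ P.Tm,
      j ≫ P.map = T ∧ I.refl (Fibrancy.canonical P A) ≫ j = d := by
  -- Uniformity in the slice is used at the object `A : Γ → Ty`: its product with `K` is a copy of
  -- `Γ.A`, and its product with `L` a copy of `Id_Γ(Γ.A)`. The maps `kE` and `kL` compare them;
  -- one-sided inverses `r` and `n` suffice below.
  let X : Over P.Ty := Over.mk A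
  let K : Over P.Ty := Over.mk P.map
  let L : Over P.Ty := Over.mk (P.disp I.Id ≫ pullback.fst P.map P.map ≫ P.map)
  let i : K ⟶ L := I.genReflOver
  let q : Over.mk (prod.fst : P.Ty ⨯ P.Tm ⟶ P.Ty) ⟶ Over.mk (prod.fst : P.Ty ⨯ P.Ty ⟶ P.Ty) :=
    Over.homMk (prod.map (𝟙 P.Ty) P.map) (by simp)
  have wK : (prod.fst : X ⨯ K ⟶ X).left ≫ A = (prod.snd : X ⨯ K ⟶ K).left ≫ P.map :=
    (Over.w (prod.fst : X ⨯ K ⟶ X)).trans (Over.w (prod.snd : X ⨯ K ⟶ K)).symm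
  have wL : (prod.fst : X ⨯ L ⟶ X).left ≫ A =
      (prod.snd : X ⨯ L ⟶ L).left ≫ P.disp I.Id ≫ pullback.fst P.map P.map ≫ P.map :=
    (Over.w (prod.fst : X ⨯ L ⟶ X)).trans (Over.w (prod.snd : X ⨯ L ⟶ L)).symm
  let kE : (X ⨯ K).left ⟶ P.ext A := ChosenPullbacksAlong.lift _ _ wK
  have kE_disp : kE ≫ P.disp A = (prod.fst : X ⨯ K ⟶ X).left :=
    ChosenPullbacksAlong.lift_fst _ _ wK
  have kE_var : kE ≫ P.var A = (prod.snd : X ⨯ K ⟶ K).left := ChosenPullbacksAlong.lift_snd _ _ wK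
  have wL₀ : (prod.fst : X ⨯ L ⟶ X).left ≫ A =
      ((prod.snd : X ⨯ L ⟶ L).left ≫ P.disp I.Id ≫ pullback.fst P.map P.map) ≫ P.map := by
    rw [wL]
    simp only [Category.assoc]
  have wL₁ : (prod.fst : X ⨯ L ⟶ X).left ≫ A =
      ((prod.snd : X ⨯ L ⟶ L).left ≫ P.disp I.Id ≫ pullback.snd P.map P.map) ≫ P.map := by
    rw [wL]
    simp only [Category.assoc, pullback.condition]
  let l₀ : (X ⨯ L).left ⟶ P.ext A := ChosenPullbacksAlong.lift _ _ wL₀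
  let l₁ : (X ⨯ L).left ⟶ P.ext A := ChosenPullbacksAlong.lift _ _ wL₁
  have l₀_disp : l₀ ≫ P.disp A = (prod.fst : X ⨯ L ⟶ X).left :=
    ChosenPullbacksAlong.lift_fst _ _ wL₀
  have l₀_var : l₀ ≫ P.var A = _ := ChosenPullbacksAlong.lift_snd _ _ wL₀
  have l₁_disp : l₁ ≫ P.disp A = (prod.fst : X ⨯ L ⟶ X).left :=
    ChosenPullbacksAlong.lift_fst _ _ wL₁
  have l₁_var : l₁ ≫ P.var A = _ := ChosenPullbacksAlong.lift_snd _ _ wL₁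
  have wk : pullback.lift l₀ l₁ (l₀_disp.trans l₁_disp.symm) ≫
      pairMap (Fibrancy.canonical P A) ≫ I.Id =
      ((prod.snd : X ⨯ L ⟶ L).left ≫ P.var I.Id) ≫ P.map := by
    rw [Category.assoc, ← ChosenPullbacksAlong.condition, ← Category.assoc, ← Category.assoc]
    congr 1
    apply pullback.hom_ext
    · simp only [pairMap, Category.assoc, pullback.lift_fst, pullback.lift_fst_assoc, l₀_var]
    · simp only [pairMap, Category.assoc, pullback.lift_snd, pullback.lift_snd_assoc, l₁_var]
  let kL : (X ⨯ L).left ⟶ I.obj (Fibrancy.canonical P A) := ChosenPullbacksAlong.lift _ _ wk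
  have kL_ends : kL ≫ I.ends _ = _ := ChosenPullbacksAlong.lift_fst _ _ wk
  have kL_var : kL ≫ P.var _ = _ := ChosenPullbacksAlong.lift_snd _ _ wk
  have kL_ev₀ : kL ≫ I.ev₀ _ = l₀ := by rw [← Category.assoc, kL_ends, pullback.lift_fst]
  have kL_ev₁ : kL ≫ I.ev₁ _ = l₁ := by rw [← Category.assoc, kL_ends, pullback.lift_snd]
  have map_fst : (prod.map (𝟙 X) i).left ≫ (prod.fst : X ⨯ L ⟶ X).left =
      (prod.fst : X ⨯ K ⟶ X).left := by
    rw [← Over.comp_left, prod.map_fst, Category.comp_id]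
  have map_snd : (prod.map (𝟙 X) i).left ≫ (prod.snd : X ⨯ L ⟶ L).left =
      (prod.snd : X ⨯ K ⟶ K).left ≫ I.genRefl := by
    rw [← Over.comp_left, prod.map_snd, Over.comp_left]
    rfl
  have hk : (prod.map (𝟙 X) i).left ≫ kL = kE ≫ I.refl (Fibrancy.canonical P A) := by
    apply obj_hom_ext
    · rw [Category.assoc, kL_ev₀, Category.assoc, refl_ev₀, Category.comp_id]
      apply ext_hom
      · rw [Category.assoc, l₀_disp, map_fst, kE_disp]
      · rw [Category.assoc, l₀_var, reassoc_of% map_snd, ← Category.assoc I.genRefl, genRefl_disp,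
          pullback.diagonal_fst, kE_var]
        exact Category.comp_id _
    · rw [Category.assoc, kL_ev₁, Category.assoc, refl_ev₁, Category.comp_id]
      apply ext_hom
      · rw [Category.assoc, l₁_disp, map_fst, kE_disp]
      · rw [Category.assoc, l₁_var, reassoc_of% map_snd, ← Category.assoc I.genRefl, genRefl_disp,
          pullback.diagonal_snd, kE_var]
        exact Category.comp_id _
    · rw [Category.assoc, kL_var, reassoc_of% map_snd, Category.assoc, refl_var, reassoc_of% kE_var,
        genRefl_var]
  -- The factor `Ty` in the target of the lifting problem only records the structure map, so maps
  -- over `Ty` amount to arbitrary maps to `Tm` and to `Ty`.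
  let a : X ⨯ K ⟶ Over.mk (prod.fst : P.Ty ⨯ P.Tm ⟶ P.Ty) :=
    Over.homMk (prod.lift (X ⨯ K).hom (kE ≫ d)) (prod.lift_fst _ _)
  let b : X ⨯ L ⟶ Over.mk (prod.fst : P.Ty ⨯ P.Ty ⟶ P.Ty) :=
    Over.homMk (prod.lift (X ⨯ L).hom (kL ≫ T)) (prod.lift_fst _ _)
  have hab : a ≫ q = prod.map (𝟙 X) i ≫ b := by
    apply Over.OverMorphism.ext
    rw [Over.comp_left, Over.comp_left]
    change prod.lift (X ⨯ K).hom (kE ≫ d) ≫ prod.map (𝟙 P.Ty) P.map =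
      (prod.map (𝟙 X) i).left ≫ prod.lift (X ⨯ L).hom (kL ≫ T)
    rw [prod.lift_map, prod.comp_lift, Category.comp_id, Over.w, reassoc_of% hk, Category.assoc, h]
  let l := UniformLifts.lift J a b hab
  have l_lower : l.left ≫ prod.map (𝟙 P.Ty) P.map = prod.lift (X ⨯ L).hom (kL ≫ T) :=
    congrArg CommaMorphism.left (UniformLifts.lower J a b hab)
  have l_upper : (prod.map (𝟙 X) i).left ≫ l.left = prod.lift (X ⨯ K).hom (kE ≫ d) :=
    congrArg CommaMorphism.left (UniformLifts.upper J a b hab)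
  have wg : (I.ends (Fibrancy.canonical P A) ≫ pairMap (Fibrancy.canonical P A)) ≫ I.Id =
      P.var (pairMap (Fibrancy.canonical P A) ≫ I.Id) ≫ P.map := by
    rw [← ChosenPullbacksAlong.condition, Category.assoc]
  let g : I.obj (Fibrancy.canonical P A) ⟶ I.gen := ChosenPullbacksAlong.lift _ _ wg
  have g_disp : g ≫ P.disp I.Id = _ := ChosenPullbacksAlong.lift_fst _ _ wg
  have g_var : g ≫ P.var I.Id = _ := ChosenPullbacksAlong.lift_snd _ _ wg
  let Z : Over P.Ty := Over.mk (I.ev₀ (Fibrancy.canonical P A) ≫ P.disp A ≫ A)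
  let n₁ : Z ⟶ X := Over.homMk (I.ev₀ (Fibrancy.canonical P A) ≫ P.disp A)
    (by simp only [X, Z, Over.mk_hom, Category.assoc])
  let n₂ : Z ⟶ L := Over.homMk g (by
    change g ≫ P.disp I.Id ≫ pullback.fst P.map P.map ≫ P.map = _
    rw [reassoc_of% g_disp, pairMap, pullback.lift_fst_assoc, Category.assoc,
      ← ChosenPullbacksAlong.condition]
    simp only [Z, Over.mk_hom, Category.assoc])
  let n : Z ⟶ X ⨯ L := prod.lift n₁ n₂
  have n_fst : n.left ≫ (prod.fst : X ⨯ L ⟶ X).left = I.ev₀ _ ≫ P.disp A := by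
    rw [← Over.comp_left, prod.lift_fst]
    rfl
  have n_snd : n.left ≫ (prod.snd : X ⨯ L ⟶ L).left = g := by
    rw [← Over.comp_left, prod.lift_snd]
    rfl
  have n_kL : n.left ≫ kL = 𝟙 _ := by
    apply obj_hom_ext
    · rw [Category.assoc, kL_ev₀, Category.id_comp]
      apply ext_hom
      · rw [Category.assoc, l₀_disp, n_fst]
      · rw [Category.assoc, l₀_var, reassoc_of% n_snd, reassoc_of% g_disp, pairMap,
          pullback.lift_fst, Category.assoc]
    · rw [Category.assoc, kL_ev₁, Category.id_comp]
      apply ext_hom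
      · rw [Category.assoc, l₁_disp, n_fst, Category.assoc, Category.assoc, pullback.condition]
      · rw [Category.assoc, l₁_var, reassoc_of% n_snd, reassoc_of% g_disp, pairMap,
          pullback.lift_snd, Category.assoc]
    · rw [Category.assoc, kL_var, reassoc_of% n_snd, g_var, Category.id_comp]
  let V : Over P.Ty := Over.mk (P.disp A ≫ A)
  let r₁ : V ⟶ X := Over.homMk (P.disp A) rfl
  let r₂ : V ⟶ K := Over.homMk (P.var A) ChosenPullbacksAlong.condition.symm
  let r : V ⟶ X ⨯ K := prod.lift r₁ r₂
  have r_kE : r.left ≫ kE = 𝟙 _ := by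
    apply ext_hom
    · rw [Category.assoc, kE_disp, ← Over.comp_left, prod.lift_fst, Category.id_comp]
      rfl
    · rw [Category.assoc, kE_var, ← Over.comp_left, prod.lift_snd, Category.id_comp]
      rfl
  let ρ : V ⟶ Z := Over.homMk (I.refl (Fibrancy.canonical P A)) (by
    change I.refl (Fibrancy.canonical P A) ≫ I.ev₀ _ ≫ P.disp A ≫ A = P.disp A ≫ A
    rw [← Category.assoc, refl_ev₀, Category.id_comp])
  -- Under the comparisons `refl` becomes `X × i`, so the upper triangle of the lift turns into the
  -- computation rule.
  have hρ : ρ ≫ n = r ≫ prod.map (𝟙 X) i := by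
    apply Limits.prod.hom_ext
    · rw [Category.assoc, Category.assoc, prod.lift_fst, prod.map_fst, Category.comp_id,
        prod.lift_fst]
      apply Over.OverMorphism.ext
      change I.refl (Fibrancy.canonical P A) ≫ I.ev₀ _ ≫ P.disp A = P.disp A
      rw [← Category.assoc, refl_ev₀, Category.id_comp]
    · rw [Category.assoc, Category.assoc, prod.lift_snd, prod.map_snd, prod.lift_snd_assoc]
      apply Over.OverMorphism.ext
      change I.refl (Fibrancy.canonical P A) ≫ g = P.var A ≫ I.genRefl
      apply ext_hom
      · rw [Category.assoc, g_disp, ← Category.assoc, refl_ends, Category.assoc, genRefl_disp]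
        apply pullback.hom_ext <;> simp [pairMap, pullback.lift_fst, pullback.lift_snd]
      · rw [Category.assoc, g_var, refl_var, Category.assoc, genRefl_var]
  have hρ' : I.refl (Fibrancy.canonical P A) ≫ n.left = r.left ≫ (prod.map (𝟙 X) i).left :=
    congrArg CommaMorphism.left hρ
  refine ⟨n.left ≫ l.left ≫ prod.snd, ?_, ?_⟩
  · have := l_lower =≫ prod.snd
    rw [Category.assoc, prod.map_snd, prod.lift_snd] at this
    rw [Category.assoc, Category.assoc, this, reassoc_of% n_kL]
  · rw [reassoc_of% hρ', reassoc_of% l_upper, prod.lift_snd, reassoc_of% r_kE]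

/-- Path induction into function types yields a normal transport structure. -/
lemma JStructure.exists_normal_transport (J : I.JStructure) (ϖ : PiStructure P) :
    ∃ T : I.TransportStructure, T.Normal := by
  let φ := Fibrancy.canonical P (P.polyBase P.Ty)
  let X₀ : I.genPath ⟶ P.Ty := I.ev₀ φ ≫ P.genTy
  let X₁ : I.genPath ⟶ P.Ty := I.ev₁ φ ≫ P.genTy
  have hX₀ : I.refl φ ≫ X₀ = P.genTy := by
    rw [← Category.assoc, refl_ev₀, Category.id_comp]
  have hX₁ : I.refl φ ≫ X₁ = P.genTy := by
    rw [← Category.assoc, refl_ev₁, Category.id_comp]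
  -- Over reflexivity both endpoint fibres become `genTy`, and the identity function, given by the
  -- generic term, inhabits the function type.
  have hid : classify P.genTy (P.var P.genTy) ≫ P.polyMap P.map =
      I.refl φ ≫ classify X₀ (P.disp X₀ ≫ X₁) := by
    rw [classify_polyMap, comp_classify hX₀]
    congr 1
    rw [← Category.assoc, wk_disp, Category.assoc, hX₁, ChosenPullbacksAlong.condition]
  obtain ⟨j, hj, hj'⟩ := J.exists_elim (P.polyBase P.Ty)
    (classify X₀ (P.disp X₀ ≫ X₁) ≫ ϖ.name) (classify P.genTy (P.var P.genTy) ≫ ϖ.point) (by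
      rw [Category.assoc, ϖ.isPullback.w, reassoc_of% hid])
  let m : I.genPath ⟶ P.polyObj P.Tm := ϖ.isPullback.lift j (classify X₀ (P.disp X₀ ≫ X₁)) hj
  have hm : m ≫ P.polyMap P.map = classify X₀ (P.disp X₀ ≫ X₁) := ϖ.isPullback.lift_snd _ _ _
  have hbase : P.polyMap P.map ≫ P.polyBase P.Ty = P.polyBase P.Tm :=
    Over.w ((ExponentiableMorphism.pushforward P.map).map _)
  -- Uncurrying: the term of the function type found by induction becomes a map `t` from the fibre
  -- at the first endpoint to terms of the fibre at the second.
  obtain ⟨t, ht⟩ := classify_surjective m X₀ (by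
    rw [← hbase, ← Category.assoc, hm, classify_base])
  have htm : t ≫ P.map = P.disp X₀ ≫ X₁ := by
    apply classify_injective
    rw [← classify_polyMap, ht, hm]
  -- The computation rule says that `t` is the identity over reflexivity; normality is read off from
  -- this.
  have htr : P.wk hX₀ ≫ t = P.var P.genTy := by
    apply classify_injective
    rw [← comp_classify hX₀, ht]
    apply ϖ.isPullback.hom_ext
    · rw [Category.assoc, ϖ.isPullback.lift_fst, hj']
    · rw [Category.assoc, hm, hid]
  have wz : pullback.fst (I.ev₀ φ) P.genFib ≫ X₀ =
      (pullback.snd (I.ev₀ φ) P.genFib ≫ P.var P.genTy) ≫ P.map := by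
    rw [Category.assoc, ← ChosenPullbacksAlong.condition, ← Category.assoc, pullback.condition,
      Category.assoc]
  let z : pullback (I.ev₀ φ) P.genFib ⟶ P.ext X₀ := ChosenPullbacksAlong.lift _ _ wz
  have z_disp : z ≫ P.disp X₀ = _ := ChosenPullbacksAlong.lift_fst _ _ wz
  have z_var : z ≫ P.var X₀ = _ := ChosenPullbacksAlong.lift_snd _ _ wz
  have wy : (pullback.fst (I.ev₀ φ) P.genFib ≫ I.ev₁ φ) ≫ P.genTy = (z ≫ t) ≫ P.map := by
    rw [Category.assoc z, htm, reassoc_of% z_disp, Category.assoc]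
  let y : pullback (I.ev₀ φ) P.genFib ⟶ P.ext P.genTy := ChosenPullbacksAlong.lift _ _ wy
  have y_disp : y ≫ P.genFib = _ := ChosenPullbacksAlong.lift_fst _ _ wy
  have y_var : y ≫ P.var P.genTy = _ := ChosenPullbacksAlong.lift_snd _ _ wy
  refine ⟨⟨pullback.lift (pullback.fst _ _) y y_disp.symm, pullback.lift_fst _ _ _⟩, ?_⟩
  intro W μ τ h
  have hμ : μ ≫ P.genTy = τ ≫ P.map := by
    rw [h, Category.assoc, ← Category.assoc (I.refl _), refl_ev₀, Category.id_comp]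
  have wτ : ((μ ≫ I.refl φ) ≫ I.ev₀ φ) ≫ P.genTy = τ ≫ P.map := by rw [Category.assoc, h]
  have key : pullback.lift (μ ≫ I.refl φ) (ChosenPullbacksAlong.lift _ τ wτ)
      (ChosenPullbacksAlong.lift_fst _ _ wτ).symm ≫ z =
      ChosenPullbacksAlong.lift μ τ hμ ≫ P.wk hX₀ := by
    apply ext_hom
    · rw [Category.assoc, z_disp, pullback.lift_fst, Category.assoc, wk_disp, ← Category.assoc,
        ChosenPullbacksAlong.lift_fst _ _ hμ]
    · rw [Category.assoc, z_var, pullback.lift_snd_assoc, ChosenPullbacksAlong.lift_snd _ _ wτ,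
        Category.assoc, wk_var, ChosenPullbacksAlong.lift_snd _ _ hμ]
  have key' := key =≫ t
  rw [Category.assoc, Category.assoc (ChosenPullbacksAlong.lift μ τ hμ), htr,
    ChosenPullbacksAlong.lift_snd _ _ hμ] at key'
  unfold TransportStructure.app
  rw [pullback.lift_snd_assoc, y_var]
  exact key'

end PreId

/-! ### Fibrancy of the object of homotopy isomorphisms. -/

section FibrantHIso

variable {P : UniversalMap C}

/-- Given a `Π`-type structure, an object over `R` classifying the terms of a type over `R.A` is
fibrant over `R`. -/
lemma nonempty_fibrancy_of_sections (ϖ : PiStructure P) {R S : C} {A : R ⟶ P.Ty}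
    {T : P.ext A ⟶ P.Ty} {p : S ⟶ R} (τ : P.ext (p ≫ A) ⟶ P.Tm) (hτ : τ ≫ P.map = P.wk rfl ≫ T)
    (uniq : ∀ {Δ : C} (g g' : Δ ⟶ S) (A' : Δ ⟶ P.Ty) (h : g ≫ p ≫ A = A') (h' : g' ≫ p ≫ A = A'),
        g ≫ p = g' ≫ p → P.wk h ≫ τ = P.wk h' ≫ τ → g = g')
    (ex : ∀ {Δ : C} (σ : Δ ⟶ R) (A' : Δ ⟶ P.Ty) (h : σ ≫ A = A') (t : P.ext A' ⟶ P.Tm),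
        t ≫ P.map = P.wk h ≫ T →
        ∃ g : Δ ⟶ S, g ≫ p = σ ∧ ∀ h' : g ≫ p ≫ A = A', P.wk h' ≫ τ = t) :
    Nonempty (Fibrancy P p) := by
  have hbase : P.polyMap P.map ≫ P.polyBase P.Ty = P.polyBase P.Tm :=
    Over.w ((ExponentiableMorphism.pushforward P.map).map _)
  have w : classify (p ≫ A) τ ≫ P.polyMap P.map = p ≫ classify A T := by
    rw [classify_polyMap, hτ, comp_classify rfl]
  -- A cone consists of a map to `R` and a term of the reindexed type, which is exactly what `S`
  -- classifies; hence `p` is a pullback of `P_π(π)`.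
  have key : ∀ s : PullbackCone (P.polyMap P.map) (classify A T),
      ∃ g : s.pt ⟶ S, g ≫ classify (p ≫ A) τ = s.fst ∧ g ≫ p = s.snd := by
    intro s
    obtain ⟨t, ht⟩ := classify_surjective s.fst (s.snd ≫ A) (by
      rw [← hbase, ← Category.assoc, s.condition, Category.assoc, classify_base])
    obtain ⟨g, hg, hg'⟩ := ex s.snd _ rfl t (by
      apply classify_injective
      rw [← classify_polyMap, ht, s.condition, comp_classify rfl])
    have h : g ≫ p ≫ A = s.snd ≫ A := by rw [← Category.assoc, hg]
    exact ⟨g, by rw [comp_classify h, hg' h, ht], hg⟩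
  choose g hg₁ hg₂ using key
  refine ⟨ϖ.ofIsPullback (α := classify (p ≫ A) τ) (β := classify A T)
    ⟨⟨w⟩, ⟨PullbackCone.IsLimit.mk _ g hg₁ hg₂ ?_⟩⟩⟩
  intro s m h₁ h₂
  have hp : m ≫ p = g s ≫ p := h₂.trans (hg₂ s).symm
  have hA : m ≫ p ≫ A = g s ≫ p ≫ A := by rw [reassoc_of% hp]
  refine uniq m (g s) _ hA rfl hp ?_
  apply classify_injective
  rw [← comp_classify hA, ← comp_classify rfl, h₁, hg₁ s]

/-- Given a `Π`-type structure, an object over `R` classifying the maps from `A` to `B` is fibrant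
over `R`. -/
lemma nonempty_fibrancy_of_homs (ϖ : PiStructure P) {R S : C} {A B : R ⟶ P.Ty} {p : S ⟶ R}
    (f : P.ext (p ≫ A) ⟶ P.ext (p ≫ B)) (hf : f ≫ P.disp (p ≫ B) = P.disp (p ≫ A))
    (uniq : ∀ {Δ : C} (g g' : Δ ⟶ S) (A' B' : Δ ⟶ P.Ty) (hA : g ≫ p ≫ A = A')
        (hB : g ≫ p ≫ B = B') (hA' : g' ≫ p ≫ A = A') (hB' : g' ≫ p ≫ B = B')
        (x : P.ext A' ⟶ P.ext B'),
        g ≫ p = g' ≫ p → P.wk hA ≫ f = x ≫ P.wk hB → P.wk hA' ≫ f = x ≫ P.wk hB' → g = g')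
    (ex : ∀ {Δ : C} (σ : Δ ⟶ R) (A' B' : Δ ⟶ P.Ty) (_ : σ ≫ A = A') (_ : σ ≫ B = B')
        (x : P.ext A' ⟶ P.ext B'), x ≫ P.disp B' = P.disp A' →
        ∃ g : Δ ⟶ S, g ≫ p = σ ∧ ∀ (hA' : g ≫ p ≫ A = A') (hB' : g ≫ p ≫ B = B'),
          P.wk hA' ≫ f = x ≫ P.wk hB') :
    Nonempty (Fibrancy P p) := by
  -- A map from `A` to `B` over the base is a term of `B` weakened to the context `R.A`.
  refine nonempty_fibrancy_of_sections ϖ (T := P.disp A ≫ B) (f ≫ P.var _) ?_ ?_ ?_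
  · rw [Category.assoc, ← ChosenPullbacksAlong.condition, reassoc_of% hf, ← Category.assoc (P.wk _),
      wk_disp, Category.assoc]
  · intro Δ g g' A' hA hA' hp h
    have hB : g ≫ p ≫ B = g' ≫ p ≫ B := by rw [reassoc_of% hp]
    refine uniq g g' A' _ hA hB hA' rfl (reindexHom hA' rfl f hf) hp ?_
      (reindexHom_wk hA' rfl f hf).symm
    have e := reindexHom_wk hA' rfl f hf
    have ed := reindexHom_disp hA' rfl f hf
    generalize reindexHom hA' rfl f hf = x at e ed
    apply ext_hom
    · rw [Category.assoc, hf, wk_disp, Category.assoc, wk_disp, reassoc_of% ed]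
    · rw [Category.assoc, h, ← reassoc_of% e, wk_var, Category.assoc, wk_var]
  · intro Δ σ A' hA t ht
    have wx : P.disp A' ≫ σ ≫ B = t ≫ P.map := by
      rw [ht, ← Category.assoc, ← Category.assoc, wk_disp]
    obtain ⟨g, hg, hg'⟩ := ex σ A' (σ ≫ B) hA rfl (ChosenPullbacksAlong.lift _ _ wx)
      (ChosenPullbacksAlong.lift_fst _ _ wx)
    refine ⟨g, hg, fun h' => ?_⟩
    rw [← Category.assoc, hg' h' (by rw [← Category.assoc, hg]), Category.assoc, wk_var,
      ChosenPullbacksAlong.lift_snd _ _ wx]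

/-- If the fibrations of `P` are fibrations of `Q`, then there is a universal instance of `HIsoData`
over a base that is fibrant over `Ty × Ty`. -/
lemma exists_fibrant_universal {Q : UniversalMap C} (σ : SigmaStructure Q) (el : Fibrancy Q P.map)
    (ϖ : PiStructure P) (I : PreId P) :
    ∃ (R : C) (D : HIsoData I R),
      (∀ {Δ : C} (x : HIsoData I Δ), ∃ g : Δ ⟶ R, IsReindexing g x D) ∧
      (∀ {Δ : C} (x : HIsoData I Δ) (g g' : Δ ⟶ R),
        IsReindexing g x D → IsReindexing g' x D → g = g') ∧
      Nonempty (Fibrancy Q (prod.lift D.A D.B)) := by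
  obtain ⟨S₁, p₁, f₁, f₁d, uniq₁, ex₁⟩ :=
    exists_homs (prod.fst : P.Ty ⨯ P.Ty ⟶ P.Ty) (prod.snd : P.Ty ⨯ P.Ty ⟶ P.Ty)
  obtain ⟨S₂, p₂, s₂, s₂d, uniq₂, ex₂⟩ :=
    exists_homs (p₁ ≫ (prod.snd : P.Ty ⨯ P.Ty ⟶ P.Ty)) (p₁ ≫ prod.fst)
  obtain ⟨S₃, p₃, r₃, r₃d, uniq₃, ex₃⟩ :=
    exists_homs (p₂ ≫ p₁ ≫ (prod.snd : P.Ty ⨯ P.Ty ⟶ P.Ty)) (p₂ ≫ p₁ ≫ prod.fst)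
  obtain ⟨A₃, hA₃⟩ : ∃ A₃ : S₃ ⟶ P.Ty, p₃ ≫ p₂ ≫ p₁ ≫ prod.fst = A₃ := ⟨_, rfl⟩
  obtain ⟨B₃, hB₃⟩ : ∃ B₃ : S₃ ⟶ P.Ty, p₃ ≫ p₂ ≫ p₁ ≫ prod.snd = B₃ := ⟨_, rfl⟩
  have qA : (p₃ ≫ p₂) ≫ p₁ ≫ prod.fst = A₃ := by rw [Category.assoc, hA₃]
  have qB : (p₃ ≫ p₂) ≫ p₁ ≫ prod.snd = B₃ := by rw [Category.assoc, hB₃]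
  let f₃ := reindexHom qA qB f₁ f₁d
  have f₃d : f₃ ≫ P.disp B₃ = P.disp A₃ := reindexHom_disp _ _ _ _
  let s₃ := reindexHom hB₃ hA₃ s₂ s₂d
  have s₃d : s₃ ≫ P.disp A₃ = P.disp B₃ := reindexHom_disp _ _ _ _
  -- Reindexing along the identity serves as a cast: the domain and codomain of `r₃` agree with `B₃`
  -- and `A₃` only up to a propositional equality of names.
  let r₃' := reindexHom (σ := 𝟙 S₃) ((Category.id_comp _).trans hB₃)
    ((Category.id_comp _).trans hA₃) r₃ r₃d
  have r₃d' : r₃' ≫ P.disp A₃ = P.disp B₃ := reindexHom_disp _ _ _ _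
  have t₃ : (f₃ ≫ s₃) ≫ P.disp A₃ = 𝟙 _ ≫ P.disp A₃ := by
    rw [Category.assoc, s₃d, f₃d, Category.id_comp]
  obtain ⟨S₄, p₄, τ₄, hτ₄, uniq₄, ex₄⟩ := exists_sections A₃ (idTy I A₃ (f₃ ≫ s₃) t₃)
  have t₄ : (r₃' ≫ f₃) ≫ P.disp B₃ = 𝟙 _ ≫ P.disp B₃ := by
    rw [Category.assoc, f₃d, r₃d', Category.id_comp]
  obtain ⟨S₅, p₅, τ₅, hτ₅, uniq₅, ex₅⟩ :=
    exists_sections (p₄ ≫ B₃) (P.wk rfl ≫ idTy I B₃ (r₃' ≫ f₃) t₄)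
  have kA : (p₅ ≫ p₄) ≫ A₃ = p₅ ≫ p₄ ≫ A₃ := Category.assoc _ _ _
  have kB : (p₅ ≫ p₄) ≫ B₃ = p₅ ≫ p₄ ≫ B₃ := Category.assoc _ _ _
  have dA : (reindexHom kA kB f₃ f₃d ≫ reindexHom kB kA s₃ s₃d) ≫ P.disp (p₅ ≫ p₄ ≫ A₃) =
      𝟙 _ ≫ P.disp (p₅ ≫ p₄ ≫ A₃) := by simp
  have dB : (reindexHom kB kA r₃' r₃d' ≫ reindexHom kA kB f₃ f₃d) ≫ P.disp (p₅ ≫ p₄ ≫ B₃) =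
      𝟙 _ ≫ P.disp (p₅ ≫ p₄ ≫ B₃) := by simp
  have wHs : (P.wk rfl ≫ τ₄) ≫ P.map = idTy I (p₅ ≫ p₄ ≫ A₃) _ dA := by
    rw [Category.assoc, hτ₄]
    exact (wk_wk_assoc rfl rfl kA _).trans (wk_idTy _ _ _ _ _ (wk_comp_reindexHom _ _ _ _ _ _))
  have wHr : τ₅ ≫ P.map = idTy I (p₅ ≫ p₄ ≫ B₃) _ dB := by
    rw [hτ₅]
    exact (wk_wk_assoc rfl rfl kB _).trans (wk_idTy _ _ _ _ _ (wk_comp_reindexHom _ _ _ _ _ _))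
  let D : HIsoData I S₅ :=
    { A := p₅ ≫ p₄ ≫ A₃
      B := p₅ ≫ p₄ ≫ B₃
      f := reindexHom kA kB f₃ f₃d
      s := reindexHom kB kA s₃ s₃d
      r := reindexHom kB kA r₃' r₃d'
      f_disp := reindexHom_disp _ _ _ _
      s_disp := reindexHom_disp _ _ _ _
      r_disp := reindexHom_disp _ _ _ _
      Hs := homotopyOfTerm _ wHs
      Hr := homotopyOfTerm _ wHr }
  have DHs : D.Hs.hom ≫ P.var _ = P.wk rfl ≫ τ₄ := homotopyOfTerm_var _ wHs
  have DHr : D.Hr.hom ≫ P.var _ = τ₅ := homotopyOfTerm_var _ wHr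
  have fib : Nonempty (Fibrancy Q (prod.lift D.A D.B)) := by
    obtain ⟨F₁⟩ := nonempty_fibrancy_of_homs ϖ f₁ f₁d uniq₁ ex₁
    obtain ⟨F₂⟩ := nonempty_fibrancy_of_homs ϖ s₂ s₂d uniq₂ ex₂
    obtain ⟨F₃⟩ := nonempty_fibrancy_of_homs ϖ r₃ r₃d uniq₃ ex₃
    obtain ⟨F₄⟩ := nonempty_fibrancy_of_sections ϖ τ₄ hτ₄ uniq₄ ex₄
    obtain ⟨F₅⟩ := nonempty_fibrancy_of_sections ϖ τ₅ hτ₅ uniq₅ ex₅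
    have hD : prod.lift D.A D.B = p₅ ≫ p₄ ≫ p₃ ≫ p₂ ≫ p₁ := by
      apply Limits.prod.hom_ext
      · rw [prod.lift_fst]
        simp only [D, ← hA₃, Category.assoc]
      · rw [prod.lift_snd]
        simp only [D, ← hB₃, Category.assoc]
    rw [hD]
    -- Each stage is fibrant for `P` by its `Π`-structure and becomes fibrant for `Q` through `el`;
    -- only the composition needs `Σ`, and only that of `Q`.
    exact ⟨.comp σ (.ofInternal el F₅) (.comp σ (.ofInternal el F₄) (.comp σ (.ofInternal el F₃)
      (.comp σ (.ofInternal el F₂) (.ofInternal el F₁))))⟩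
  refine ⟨S₅, D, ?_, ?_, fib⟩
  · intro Δ x
    let σ₀ : Δ ⟶ P.Ty ⨯ P.Ty := prod.lift x.A x.B
    have hA₀ : σ₀ ≫ prod.fst = x.A := prod.lift_fst _ _
    have hB₀ : σ₀ ≫ prod.snd = x.B := prod.lift_snd _ _
    obtain ⟨g₁, e₁, c₁⟩ := ex₁ σ₀ x.A x.B hA₀ hB₀ x.f x.f_disp
    have hA₁ : g₁ ≫ p₁ ≫ prod.fst = x.A := by rw [← Category.assoc, e₁, hA₀]
    have hB₁ : g₁ ≫ p₁ ≫ prod.snd = x.B := by rw [← Category.assoc, e₁, hB₀]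
    obtain ⟨g₂, e₂, c₂⟩ := ex₂ g₁ x.B x.A hB₁ hA₁ x.s x.s_disp
    have hA₂ : g₂ ≫ p₂ ≫ p₁ ≫ prod.fst = x.A := by rw [← Category.assoc, e₂, hA₁]
    have hB₂ : g₂ ≫ p₂ ≫ p₁ ≫ prod.snd = x.B := by rw [← Category.assoc, e₂, hB₁]
    obtain ⟨g₃, e₃, c₃⟩ := ex₃ g₂ x.B x.A hB₂ hA₂ x.r x.r_disp
    have hA₃' : g₃ ≫ p₃ ≫ p₂ ≫ p₁ ≫ prod.fst = x.A := by rw [← Category.assoc, e₃, hA₂]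
    have hB₃' : g₃ ≫ p₃ ≫ p₂ ≫ p₁ ≫ prod.snd = x.B := by rw [← Category.assoc, e₃, hB₂]
    have hA₃'' : g₃ ≫ A₃ = x.A := by rw [← hA₃, hA₃']
    have hB₃'' : g₃ ≫ B₃ = x.B := by rw [← hB₃, hB₃']
    have f_eq : P.wk hA₃'' ≫ f₃ = x.f ≫ P.wk hB₃'' :=
      (reindexHom_iff qA qB f₁ f₁d hA₃'' hB₃'' (τ := g₁) (by rw [← Category.assoc, e₃, e₂])
        hA₁ hB₁ x.f x.f_disp).2 (c₁ hA₁ hB₁)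
    have s_eq : P.wk hB₃'' ≫ s₃ = x.s ≫ P.wk hA₃'' :=
      (reindexHom_iff hB₃ hA₃ s₂ s₂d hB₃'' hA₃'' e₃ hB₂ hA₂ x.s x.s_disp).2 (c₂ hB₂ hA₂)
    have r_eq : P.wk hB₃'' ≫ r₃' = x.r ≫ P.wk hA₃'' :=
      (reindexHom_iff _ _ r₃ r₃d hB₃'' hA₃'' (Category.comp_id _) hB₃' hA₃' x.r x.r_disp).2
        (c₃ hB₃' hA₃')
    obtain ⟨g₄, e₄, c₄⟩ := ex₄ g₃ x.A hA₃'' (x.Hs.hom ≫ P.var _) (by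
      rw [homotopy_var]
      refine (wk_idTy _ _ _ _ _ ?_).symm
      rw [← Category.assoc, f_eq, Category.assoc, s_eq, Category.assoc])
    have hA₄ : g₄ ≫ p₄ ≫ A₃ = x.A := by rw [← Category.assoc, e₄, hA₃'']
    have hB₄ : g₄ ≫ p₄ ≫ B₃ = x.B := by rw [← Category.assoc, e₄, hB₃'']
    obtain ⟨g₅, e₅, c₅⟩ := ex₅ g₄ x.B hB₄ (x.Hr.hom ≫ P.var _) (by
      rw [homotopy_var]
      refine ((wk_wk_assoc rfl hB₄ (by rw [e₄, hB₃'']) _).trans (wk_idTy _ _ _ _ _ ?_)).symm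
      obtain rfl := e₄
      rw [← Category.assoc, r_eq, Category.assoc, f_eq, Category.assoc])
    have hA₅ : g₅ ≫ p₅ ≫ p₄ ≫ A₃ = x.A := by rw [← Category.assoc, e₅, hA₄]
    have hB₅ : g₅ ≫ p₅ ≫ p₄ ≫ B₃ = x.B := by rw [← Category.assoc, e₅, hB₄]
    have e : g₅ ≫ p₅ ≫ p₄ = g₃ := by rw [← Category.assoc, e₅, e₄]
    refine ⟨g₅, hA₅, hB₅, ?_, ?_, ?_, ?_, ?_⟩
    · exact (reindexHom_iff kA kB f₃ f₃d hA₅ hB₅ e hA₃'' hB₃'' x.f x.f_disp).2 f_eq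
    · exact (reindexHom_iff kB kA s₃ s₃d hB₅ hA₅ e hB₃'' hA₃'' x.s x.s_disp).2 s_eq
    · exact (reindexHom_iff kB kA r₃' r₃d' hB₅ hA₅ e hB₃'' hA₃'' x.r x.r_disp).2 r_eq
    · rw [DHs, ← Category.assoc, wk_wk rfl hA₅ (by rw [e₅, hA₄])]
      obtain rfl := e₅
      exact c₄ hA₄
    · rw [DHr]
      exact c₅ hB₅
  · intro Δ x g g' ⟨hA, hB, hf, hs, hr, hHs, hHr⟩ ⟨hA', hB', hf', hs', hr', hHs', hHr'⟩
    -- The reindexing conditions on `D` are translated back to the generic maps `f₁`, `s₂`, `r₃` at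
    -- their own stages, so that uniqueness can climb the tower from `Ty × Ty`.
    have key : ∀ g : Δ ⟶ S₅, ∀ (hA : g ≫ D.A = x.A) (hB : g ≫ D.B = x.B)
        (hf : P.wk hA ≫ D.f = x.f ≫ P.wk hB) (hs : P.wk hB ≫ D.s = x.s ≫ P.wk hA)
        (hr : P.wk hB ≫ D.r = x.r ≫ P.wk hA),
        ∃ (hA₁ : (g ≫ p₅ ≫ p₄ ≫ p₃ ≫ p₂) ≫ p₁ ≫ prod.fst = x.A)
          (hB₁ : (g ≫ p₅ ≫ p₄ ≫ p₃ ≫ p₂) ≫ p₁ ≫ prod.snd = x.B)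
          (hA₂ : (g ≫ p₅ ≫ p₄ ≫ p₃) ≫ p₂ ≫ p₁ ≫ prod.fst = x.A)
          (hB₂ : (g ≫ p₅ ≫ p₄ ≫ p₃) ≫ p₂ ≫ p₁ ≫ prod.snd = x.B)
          (hA₃ : (g ≫ p₅ ≫ p₄) ≫ p₃ ≫ p₂ ≫ p₁ ≫ prod.fst = x.A)
          (hB₃ : (g ≫ p₅ ≫ p₄) ≫ p₃ ≫ p₂ ≫ p₁ ≫ prod.snd = x.B),
          P.wk hA₁ ≫ f₁ = x.f ≫ P.wk hB₁ ∧ P.wk hB₂ ≫ s₂ = x.s ≫ P.wk hA₂ ∧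
          P.wk hB₃ ≫ r₃ = x.r ≫ P.wk hA₃ := by
      intro g hA hB hf hs hr
      have mA : (g ≫ p₅ ≫ p₄) ≫ A₃ = x.A := by rw [← hA]; simp [D]
      have mB : (g ≫ p₅ ≫ p₄) ≫ B₃ = x.B := by rw [← hB]; simp [D]
      have hf₃ := (reindexHom_iff kA kB f₃ f₃d hA hB rfl mA mB x.f x.f_disp).1 hf
      have hs₃ := (reindexHom_iff kB kA s₃ s₃d hB hA rfl mB mA x.s x.s_disp).1 hs
      have hr₃ := (reindexHom_iff kB kA r₃' r₃d' hB hA rfl mB mA x.r x.r_disp).1 hr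
      have hA₁ : (g ≫ p₅ ≫ p₄ ≫ p₃ ≫ p₂) ≫ p₁ ≫ prod.fst = x.A := by
        rw [← mA, ← hA₃]; simp only [Category.assoc]
      have hB₁ : (g ≫ p₅ ≫ p₄ ≫ p₃ ≫ p₂) ≫ p₁ ≫ prod.snd = x.B := by
        rw [← mB, ← hB₃]; simp only [Category.assoc]
      have hA₂ : (g ≫ p₅ ≫ p₄ ≫ p₃) ≫ p₂ ≫ p₁ ≫ prod.fst = x.A := by
        rw [← hA₁]; simp only [Category.assoc]
      have hB₂ : (g ≫ p₅ ≫ p₄ ≫ p₃) ≫ p₂ ≫ p₁ ≫ prod.snd = x.B := by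
        rw [← hB₁]; simp only [Category.assoc]
      have nA : (g ≫ p₅ ≫ p₄) ≫ p₃ ≫ p₂ ≫ p₁ ≫ prod.fst = x.A := by
        rw [← hA₁]; simp only [Category.assoc]
      have nB : (g ≫ p₅ ≫ p₄) ≫ p₃ ≫ p₂ ≫ p₁ ≫ prod.snd = x.B := by
        rw [← hB₁]; simp only [Category.assoc]
      refine ⟨hA₁, hB₁, hA₂, hB₂, nA, nB, ?_, ?_, ?_⟩
      · exact (reindexHom_iff qA qB f₁ f₁d mA mB (by simp only [Category.assoc]) hA₁ hB₁
          x.f x.f_disp).1 hf₃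
      · exact (reindexHom_iff hB₃ hA₃ s₂ s₂d mB mA (by simp only [Category.assoc]) hB₂ hA₂
          x.s x.s_disp).1 hs₃
      · exact (reindexHom_iff _ _ r₃ r₃d mB mA (Category.comp_id _) nB nA x.r x.r_disp).1 hr₃
    obtain ⟨a₁, b₁, a₂, b₂, a₃, b₃, hf₁, hs₂, hr₃⟩ := key g hA hB hf hs hr
    obtain ⟨a₁', b₁', a₂', b₂', a₃', b₃', hf₁', hs₂', hr₃'⟩ := key g' hA' hB' hf' hs' hr'
    have e₀ : (g ≫ p₅ ≫ p₄ ≫ p₃ ≫ p₂) ≫ p₁ = (g' ≫ p₅ ≫ p₄ ≫ p₃ ≫ p₂) ≫ p₁ := by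
      apply Limits.prod.hom_ext
      · rw [Category.assoc _ p₁, Category.assoc _ p₁, a₁, a₁']
      · rw [Category.assoc _ p₁, Category.assoc _ p₁, b₁, b₁']
    have e₁ : g ≫ p₅ ≫ p₄ ≫ p₃ ≫ p₂ = g' ≫ p₅ ≫ p₄ ≫ p₃ ≫ p₂ :=
      uniq₁ _ _ x.A x.B a₁ b₁ a₁' b₁' x.f e₀ hf₁ hf₁'
    have e₂ : g ≫ p₅ ≫ p₄ ≫ p₃ = g' ≫ p₅ ≫ p₄ ≫ p₃ :=
      uniq₂ _ _ x.B x.A b₂ a₂ b₂' a₂' x.s (by simpa only [Category.assoc] using e₁) hs₂ hs₂'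
    have e₃ : g ≫ p₅ ≫ p₄ = g' ≫ p₅ ≫ p₄ :=
      uniq₃ _ _ x.B x.A b₃ a₃ b₃' a₃' x.r (by simpa only [Category.assoc] using e₂) hr₃ hr₃'
    have e₄ : g ≫ p₅ = g' ≫ p₅ := by
      have n : (g ≫ p₅) ≫ p₄ ≫ A₃ = x.A := by rw [← hA, Category.assoc]
      have n' : (g' ≫ p₅) ≫ p₄ ≫ A₃ = x.A := by rw [← hA', Category.assoc]
      refine uniq₄ _ _ x.A n n' (by simpa only [Category.assoc] using e₃) ?_
      rw [← wk_wk rfl hA n, ← wk_wk rfl hA' n', Category.assoc, Category.assoc, ← DHs, hHs, hHs']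
    refine uniq₅ _ _ x.B hB hB' e₄ ?_
    rw [← DHr, hHr, hHr']

/-- The tower and `HIso I` represent the same presheaf, so they are isomorphic over `Ty × Ty` and
the fibrancy structure transfers. -/
lemma nonempty_fibrancy_src_tgt {Q : UniversalMap C} (σ : SigmaStructure Q)
    (el : Fibrancy Q P.map) (ϖ : PiStructure P) (I : PreId P) :
    Nonempty (Fibrancy Q (prod.lift (src I) (tgt I))) := by
  obtain ⟨R, D, ex, uniq, ⟨φ⟩⟩ := exists_fibrant_universal σ el ϖ I
  obtain ⟨g, hg⟩ := ex (genericHIso I)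
  let k : R ⟶ HIso I := (hIsoRepr I).homEquiv.symm D
  have hk : (genericHIso I).reindex k = D := by
    have h := (hIsoRepr I).homEquiv_comp k (𝟙 (HIso I))
    rw [Category.comp_id] at h
    exact h.symm.trans ((hIsoRepr I).homEquiv.apply_symm_apply _)
  have hk' : IsReindexing k D (genericHIso I) := hk ▸ (genericHIso I).isReindexing k
  have kg : k ≫ g = 𝟙 R := uniq D _ _ (hk'.comp hg) (IsReindexing.refl D)
  have gk : g ≫ k = 𝟙 (HIso I) := by
    apply (hIsoRepr I).homEquiv.injective
    have h := (hIsoRepr I).homEquiv_comp (g ≫ k) (𝟙 (HIso I))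
    rw [Category.comp_id] at h
    exact h.trans (((genericHIso I).isReindexing (g ≫ k)).unique (hg.comp hk'))
  have w : g ≫ prod.lift D.A D.B = prod.lift (src I) (tgt I) := by
    rw [prod.comp_lift, hg.hA, hg.hB]
    rfl
  have : IsIso g := ⟨k, gk, kg⟩
  exact ⟨φ.ofIsPullback (β := 𝟙 _) (IsPullback.of_horiz_isIso ⟨by rw [w, Category.comp_id]⟩)⟩

end FibrantHIso

/-! ### Projections from products with a fibrant object. -/

section FibrantProjections

variable {P : UniversalMap C} {X : C}

lemma isPullback_terminal_prod (Y : C) :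
    IsPullback (prod.fst : X ⨯ Y ⟶ X) prod.snd (terminal.from X) (terminal.from Y) :=
  ⟨⟨Subsingleton.elim _ _⟩, ⟨PullbackCone.IsLimit.mk _ (fun s => prod.lift s.fst s.snd)
    (fun _ => prod.lift_fst _ _) (fun _ => prod.lift_snd _ _) (fun s m h₁ h₂ => by
      apply Limits.prod.hom_ext
      · rw [prod.lift_fst, h₁]
      · rw [prod.lift_snd, h₂])⟩⟩

/-- The second projection from a product with a fibrant object is a fibration. -/
def Fibrancy.prodSnd (φ : Fibrancy P (terminal.from X)) (Y : C) :
    Fibrancy P (prod.snd : X ⨯ Y ⟶ Y) :=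
  φ.ofIsPullback (isPullback_terminal_prod Y)

/-- The first projection from a product with a fibrant object is a fibration. -/
def Fibrancy.prodFst (φ : Fibrancy P (terminal.from X)) (Y : C) :
    Fibrancy P (prod.fst : Y ⨯ X ⟶ Y) :=
  φ.ofIsPullback (isPullback_terminal_prod X).flip

end FibrantProjections

/-! ### Lifts against arbitrary fibrations. -/

section LiftsAgainstFibrations

variable {P : UniversalMap C} {K L E B : C} {i : K ⟶ L} {e : E ⟶ B}

/-- A fibration is a pullback of the universal map, so a lift against the latter, taken at the
terminal parameter object, induces one against the former. -/
lemma UniformLowerLifts.exists_lift (l : UniformLowerLifts i P.map) (φ : Fibrancy P e)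
    (a : K ⟶ E) (b : L ⟶ B) (h : a ≫ e = i ≫ b) : ∃ d : L ⟶ E, d ≫ e = b := by
  have hs : (prod.snd ≫ a ≫ φ.point : (⊤_ C) ⨯ K ⟶ P.Tm) ≫ P.map =
      prod.map (𝟙 _) i ≫ prod.snd ≫ b ≫ φ.name := by
    rw [prod.map_snd_assoc, Category.assoc, Category.assoc, φ.isPullback.w, reassoc_of% h]
  have w : (prod.lift (terminal.from L) (𝟙 L) ≫ l.lift _ _ hs) ≫ P.map = b ≫ φ.name := by
    rw [Category.assoc, l.lower, prod.lift_snd_assoc, Category.id_comp]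
  exact ⟨φ.isPullback.lift _ _ w, φ.isPullback.lift_snd _ _ _⟩

/-- As for lower-half lifts; the upper triangle is checked on the two legs of the fibrancy pullback,
using the given lift on one and the square itself on the other. -/
lemma UniformLifts.hasLift (l : UniformLifts i P.map) (φ : Fibrancy P e)
    {a : K ⟶ E} {b : L ⟶ B} (sq : CommSq a i e b) : sq.HasLift := by
  have hs : (prod.snd ≫ a ≫ φ.point : (⊤_ C) ⨯ K ⟶ P.Tm) ≫ P.map =
      prod.map (𝟙 _) i ≫ prod.snd ≫ b ≫ φ.name := by
    rw [prod.map_snd_assoc, Category.assoc, Category.assoc, φ.isPullback.w, reassoc_of% sq.w]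
  have w : (prod.lift (terminal.from L) (𝟙 L) ≫ l.lift _ _ hs) ≫ P.map = b ≫ φ.name := by
    rw [Category.assoc, l.lower, prod.lift_snd_assoc, Category.id_comp]
  refine ⟨⟨⟨φ.isPullback.lift _ _ w, ?_, φ.isPullback.lift_snd _ _ _⟩⟩⟩
  apply φ.isPullback.hom_ext
  · have hi : i ≫ prod.lift (terminal.from L) (𝟙 L) =
        prod.lift (terminal.from K) (𝟙 K) ≫ prod.map (𝟙 _) i := by
      rw [prod.comp_lift, prod.lift_map, Category.comp_id, Category.id_comp, Category.comp_id,
        terminal.comp_from]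
    rw [Category.assoc, φ.isPullback.lift_fst, reassoc_of% hi, l.upper, prod.lift_snd_assoc,
      Category.id_comp]
  · rw [Category.assoc, φ.isPullback.lift_snd, sq.w]

end LiftsAgainstFibrations

/-! ### Univalence and contracting homotopies. -/

section Univalence

variable {P P₀ : UniversalMap C} {I₀ : PreId P₀}

lemma nonempty_homotopy_iff_hasLowerHalfLift (I : PreId P) {p : HIso I₀ ⟶ P₀.Ty}
    (hp : trv I₀ ≫ p = 𝟙 P₀.Ty) (φ : Fibrancy P p) :
    Nonempty (I.Homotopy φ (p ≫ trv I₀) (𝟙 (HIso I₀)) (retract_over hp)) ↔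
      HasLowerHalfLift (retractSquare I hp φ) :=
  ⟨fun ⟨H⟩ => ⟨H.hom, H.w⟩, fun ⟨l, hl⟩ => ⟨⟨l, hl⟩⟩⟩

/-- Since `p ∘ trv` is the identity, constancy along `trv` is the upper triangle and the endpoint
condition the lower one. -/
lemma nonempty_constHomotopy_iff_hasLift (I : PreId P) {p : HIso I₀ ⟶ P₀.Ty}
    (hp : trv I₀ ≫ p = 𝟙 P₀.Ty) (φ : Fibrancy P p) :
    Nonempty (I.ConstHomotopy φ (trv I₀) (p ≫ trv I₀) (𝟙 (HIso I₀)) (retract_over hp)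
      (trv_retract hp)) ↔ (retractSquare I hp φ).HasLift := by
  have e : (trv I₀ ≫ p ≫ trv I₀) ≫ I.refl φ = trv I₀ ≫ I.refl φ := by rw [reassoc_of% hp]
  constructor
  · rintro ⟨H⟩
    exact ⟨⟨⟨H.hom, H.const.trans e, H.w⟩⟩⟩
  · rintro ⟨⟨l⟩⟩
    exact ⟨⟨⟨l.l, l.fac_right⟩, l.fac_left.trans e.symm⟩⟩

/-- With `ψ` given, only the lifts matter: one way they are tested against the fibration `ev_∂`, the
other way they come from transport along the homotopy, with `trv` as section of `p`. -/
lemma nonempty_bookUnivalence_iff {I : PreId P} (T : I.TransportStructure)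
    (ψ : Fibrancy P (prod.lift (src I₀) (tgt I₀))) {p : HIso I₀ ⟶ P₀.Ty}
    (hp : trv I₀ ≫ p = 𝟙 P₀.Ty) (φ : Fibrancy P p) :
    Nonempty (BookUnivalence P I₀) ↔
      Nonempty (I.Homotopy φ (p ≫ trv I₀) (𝟙 (HIso I₀)) (retract_over hp)) := by
  constructor
  · rintro ⟨U⟩
    exact (nonempty_homotopy_iff_hasLowerHalfLift I hp φ).2
      (U.lifts.exists_lift (Fibrancy.canonical P _) _ _ (retractSquare I hp φ).w)
  · rintro ⟨H⟩
    exact ⟨⟨ψ, T.lowerLifts H⟩⟩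

lemma nonempty_pointedUnivalence_iff {I : PreId P} {T : I.TransportStructure} (hT : T.Normal)
    (ψ : Fibrancy P (prod.lift (src I₀) (tgt I₀))) {p : HIso I₀ ⟶ P₀.Ty}
    (hp : trv I₀ ≫ p = 𝟙 P₀.Ty) (φ : Fibrancy P p) :
    Nonempty (PointedUnivalence P I₀) ↔
      Nonempty (I.ConstHomotopy φ (trv I₀) (p ≫ trv I₀) (𝟙 (HIso I₀)) (retract_over hp)
        (trv_retract hp)) := by
  constructor
  · rintro ⟨U⟩
    exact (nonempty_constHomotopy_iff_hasLift I hp φ).2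
      (U.lifts.hasLift (Fibrancy.canonical P _) _)
  · rintro ⟨H⟩
    exact ⟨⟨ψ, T.lifts H.toHomotopy hT hp H.const⟩⟩

end Univalence

end UnivCat

end

/-! ### The main theorem. -/

theorem mainTheorem1 {C : Type u} [Category.{v} C] [HasFiniteLimits C]
    (P : UnivCat.UniversalMap C) (I : UnivCat.PreId P)
    (_piP : UnivCat.PiStructure P) (_sigmaP : UnivCat.SigmaStructure P)
    (U₀ : UnivCat.InternalUniverse P) (I₀ : UnivCat.PreId U₀.univ)
    (_pi₀ : UnivCat.PiStructure U₀.univ) (_sigma₀ : UnivCat.SigmaStructure U₀.univ) :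
    (Nonempty (UnivCat.Fibrancy P (UnivCat.src I₀)) ∧
      Nonempty (UnivCat.Fibrancy P (UnivCat.tgt I₀))) ∧
    ∀ (p : UnivCat.HIso I₀ ⟶ U₀.univ.Ty) (hp : UnivCat.trv I₀ ≫ p = 𝟙 U₀.univ.Ty),
      (p = UnivCat.src I₀ ∨ p = UnivCat.tgt I₀) → ∀ φ : UnivCat.Fibrancy P p,
      (Nonempty I.TransportStructure →
        ((Nonempty (UnivCat.BookUnivalence P I₀) ↔
            Nonempty (I.Homotopy φ (p ≫ UnivCat.trv I₀) (𝟙 (UnivCat.HIso I₀))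
              (UnivCat.retract_over hp))) ∧
          (Nonempty (UnivCat.BookUnivalence P I₀) ↔
            UnivCat.HasLowerHalfLift (UnivCat.retractSquare I hp φ)))) ∧
      (Nonempty I.JStructure →
        ((Nonempty (UnivCat.PointedUnivalence P I₀) ↔
            Nonempty (I.ConstHomotopy φ (UnivCat.trv I₀) (p ≫ UnivCat.trv I₀)
              (𝟙 (UnivCat.HIso I₀)) (UnivCat.retract_over hp) (UnivCat.trv_retract hp))) ∧
          (Nonempty (UnivCat.PointedUnivalence P I₀) ↔
            (UnivCat.retractSquare I hp φ).HasLift))) := by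
  obtain ⟨ψ⟩ := UnivCat.nonempty_fibrancy_src_tgt _sigmaP U₀.el _pi₀ I₀
  refine ⟨⟨⟨?_⟩, ⟨?_⟩⟩, fun p hp _ φ => ⟨?_, ?_⟩⟩
  -- `src` is `(src, tgt)` followed by a projection, which is a fibration because the universe of
  -- codes is fibrant.
  · rw [← prod.lift_fst (UnivCat.src I₀) (UnivCat.tgt I₀)]
    exact .comp _sigmaP ψ (U₀.code.prodFst _)
  · rw [← prod.lift_snd (UnivCat.src I₀) (UnivCat.tgt I₀)]
    exact .comp _sigmaP ψ (U₀.code.prodSnd _)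
  · rintro ⟨T⟩
    have h := UnivCat.nonempty_bookUnivalence_iff T ψ hp φ
    exact ⟨h, h.trans (UnivCat.nonempty_homotopy_iff_hasLowerHalfLift I hp φ)⟩
  · rintro ⟨J⟩
    obtain ⟨T, hT⟩ := UnivCat.PreId.JStructure.exists_normal_transport J _piP
    have h := UnivCat.nonempty_pointedUnivalence_iff hT ψ hp φ
    exact ⟨h, h.trans (UnivCat.nonempty_constHomotopy_iff_hasLift I hp φ)⟩
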